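/- Let $\Bbbk$ be a field of characteristic $0$ and let $\tau$ be the flip. **Poisson side.** Let $(P,\cdot,[-,-],\Delta,\delta)$ be a finite-dimensional Poisson bialgebra. That is: $(P,\cdot)$ is commutative associative (not necessarily unital), $(P,[-,-])$ is a Lie algebra and $[a,bc]=[a,b]c+b[a,c]$; $\Delta,\delta:P\to P\otimes P$ satisfy the dual (coalgebra) identities; and, with $u(a)b=ab$, $\mathrm{ad}(a)b=[a,b]$, $$\Delta(ab)=(u(b)\otimes \mathrm{id})\Delta(a)+(\mathrm{id}\otimes u(a))\Delta(b),$$ $$\delta([a,b])=(\mathrm{ad}(a)\otimes \mathrm{id}+\mathrm{id}\otimes \mathrm{ad}(a))\delta(b)-(\mathrm{ad}(b)\otimes \mathrm{id}+\mathrm{id}\otimes \mathrm{ad}(b))\delta(a),$$ $$\Delta([a,b])=(\mathrm{ad}(a)\otimes \mathrm{id}+\mathrm{id}\otimes \mathrm{ad}(a))\Delta(b)+(u(b)\otimes \mathrm{id}-\mathrm{id}\otimes u(b))\delta(a),$$ $$\delta(ab)=(u(a)\otimes \mathrm{id})\delta(b)+(u(b)\otimes \mathrm{id})\delta(a)+(\mathrm{id}\otimes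 \mathrm{ad}(a))\Delta(b)+(\mathrm{id}\otimes \mathrm{ad}(b))\Delta(a).$$ For $r=\sum_i x_i\otimes y_i\in P\otimes P$ put $\Delta_r(p)=(\mathrm{id}\otimes u(p)-u(p)\otimes \mathrm{id})(r)$ and $\delta_r(p)=(\mathrm{id}\otimes \mathrm{ad}(p)+\mathrm{ad}(p)\otimes \mathrm{id})(r)$. The Poisson bialgebra is *coboundary* (associated with $r$) if $\Delta=\Delta_r$ and $\delta=\delta_r$; it is *quasi-triangular* (resp. *triangular*) if moreover $r_{12}r_{13}+r_{13}r_{23}-r_{23}r_{12}=0$, $[r_{12},r_{13}]+[r_{13},r_{23}]+[r_{12},r_{23}]=0$, and $\Delta_{r+\tau(r)}=\delta_{r+\tau(r)}=0$ (resp. $r=-\tau(r)$). **Perm side.** Let $B=\bigoplus_{i\in\mathbb Z}B_i$ have finite-dimensional pieces, with a graded product $\circ_B$ satisfying $a\circ_B(b\circ_B c)=(a\circ_B b)\circ_B c=(b\circ_B a)\circ_B c$, and with a nondegenerate skew-symmetric form $\omega$ such that $\omega(a\circ_B b,c)=\omega(a,b\circ_B c-c\circ_B b)$ and, for some $m\in\mathbb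 Z$, $\omega(B_i,B_j)=0$ whenever $i+j+m\ne0$. For graded $U,V$ write $U\hat\otimes V=\prod_{i,j}U_i\otimes V_j$ (similarly for three factors); hats denote the extensions of maps to completed tensor products by formal sums. Let $\nu_\omega:B\to B\hat\otimes B$ be the unique linear map with $\hat\omega(\nu_\omega(b),s\otimes t)=-\omega(b,s\circ_B t)$ for all $b,s,t\in B$. **Induced structure.** Let $A=P\otimes B$, graded by $A_i=P\otimes B_i$, with $(p\otimes b)\circ(q\otimes c)=pq\otimes (b\circ_B c)$, $(p\otimes b)*(q\otimes c)=[p,q]\otimes(b\circ_B c)$, $\nu(p\otimes b)=\Delta(p)\bullet\nu_\omega(b)$, $\vartheta(p\otimes b)=\delta(p)\bullet\nu_\omega(b)$, where $(p\otimes q)\bullet(b\otimes c)=(p\otimes b)\otimes(q\otimes c)$. Write $L_\circ,R_\circ,L_*,R_*$ for left and right multiplications in $A$. A *completed dual pre-Poisson (DPP) bialgebra* is a graded space $A$ with finite-dimensional pieces, graded products $\circ,*$ and linear maps $\nu,\vartheta:A\to A\hat\otimes A$ such that: (a) $\circ$ satisfies the two identities of $\circ_B$ above, $a*(b*c)=(a*b)*c+b*(a*c)$,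 $(a\circ b)*c=a\circ(b*c)+b\circ(a*c)$ and $(a*b)\circ c=a*(b\circ c)-b\circ(a*c)=-(b*a)\circ c$; (b) the maps $(\mu\hat\otimes\mathrm{id})\mu'$ and $(\mathrm{id}\hat\otimes\mu)\mu'$, $\mu,\mu'\in\{\nu,\vartheta\}$, are well defined (in each multidegree only finitely many terms are nonzero), and $(\nu\hat\otimes \mathrm{id})\nu=(\mathrm{id}\hat\otimes\nu)\nu=(\hat\tau\hat\otimes \mathrm{id})(\nu\hat\otimes \mathrm{id})\nu$, $(\mathrm{id}\hat\otimes\vartheta)\vartheta=(\vartheta\hat\otimes \mathrm{id})\vartheta+(\hat\tau\hat\otimes \mathrm{id})(\mathrm{id}\hat\otimes\vartheta)\vartheta$, $(\mathrm{id}\hat\otimes\nu)\vartheta=(\vartheta\hat\otimes \mathrm{id})\nu+(\hat\tau\hat\otimes \mathrm{id})(\mathrm{id}\hat\otimes\vartheta)\nu$, $(\nu\hat\otimes \mathrm{id})\vartheta=(\mathrm{id}\hat\otimes\vartheta)\nu+(\hat\tau\hat\otimes \mathrm{id})(\mathrm{id}\hat\otimes\vartheta)\nu$, $(\vartheta\hat\otimes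 \mathrm{id})\nu=-(\hat\tau\hat\otimes \mathrm{id})(\vartheta\hat\otimes \mathrm{id})\nu$; (c) for all $a,b\in A$, with $\nu^-=\nu-\hat\tau\nu$, $\vartheta^+=\vartheta+\hat\tau\vartheta$ and writing $f_1=f\hat\otimes \mathrm{id}$, $f_2=\mathrm{id}\hat\otimes f$, $$R_\circ(a)_1\nu(b)=\hat\tau(R_\circ(b)_1\nu(a)),\qquad \nu(a\circ b)=(L_\circ-R_\circ)(a)_1\nu(b)+R_\circ(b)_2\nu(a),$$ $$\nu(a\circ b)=L_\circ(a)_2\nu(b)+(L_\circ-R_\circ)(b)_1\nu^-(a),\qquad \hat\tau(R_*(b)_1\vartheta(a))=R_*(a)_1\vartheta(b),$$ $$\vartheta(a*b)=(R_*(b)_2-(L_*+R_*)(b)_1)\vartheta^+(a)+(L_*(a)_2+L_*(a)_1)\vartheta(b),$$ $$\nu(a*b)=(L_*(a)_2+L_*(a)_1)\nu(b)+((L_\circ-R_\circ)(b)_1-R_\circ(b)_2)\vartheta^+(a),$$ $$\vartheta(a\circ b)=L_\circ(a)_2\vartheta(b)+R_\circ(b)_2\vartheta(a)-(L_*+R_*)(a)_1\nu(b)-(L_*+R_*)(b)_1\nu^-(a),$$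 $$R_*(a)_2\hat\tau(\nu(b))=-R_\circ(b)_1\vartheta(a),$$ $$\nu(a*b)=(L_\circ(a)_2-L_\circ(a)_1)\vartheta(b)+(R_*(b)_2-(L_*+R_*)(b)_1)\nu^-(a),$$ $$\vartheta^+(a\circ b)=L_\circ(a)_2\vartheta^+(b)+L_\circ(b)_2\vartheta^+(a)-L_*(a)_1\nu^-(b)-L_*(b)_1\nu^-(a),$$ $$\vartheta(a\circ b)=L_\circ(a)_1\vartheta(b)-R_*(b)_2\nu^-(a)+L_*(a)_2\nu(b)+(L_\circ-R_\circ)(b)_1\vartheta^+(a),$$ $$\nu(a*b+b*a)=(L_*+R_*)(a)_2\nu(b)+(L_*+R_*)(a)_1\hat\tau\nu(b)+(L_\circ-R_\circ)(b)_2\vartheta(a)+(L_\circ-R_\circ)(b)_1\hat\tau\vartheta(a).$$ For $s\in A\hat\otimes A$ put $\nu_s(a)=(\mathrm{id}\hat\otimes R_\circ(a)+(R_\circ-L_\circ)(a)\hat\otimes \mathrm{id})(s)$ and $\vartheta_s(a)=((L_*+R_*)(a)\hat\otimes \mathrm{id}-\mathrm{id}\hat\otimes R_*(a))(s)$. A completed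 DPP bialgebra is *coboundary* (associated with $s$) if $\nu=\nu_s$ and $\vartheta=\vartheta_s$; it is *quasi-triangular* (resp. *triangular*) if moreover all products below are well defined in $A\hat\otimes A\hat\otimes A$, $$s_{12}\circ s_{23}-s_{13}\circ s_{23}+s_{12}\circ s_{13}-s_{13}\circ s_{12}=0,\qquad s_{12}*s_{13}-s_{12}*s_{23}-s_{23}*s_{12}+s_{23}*s_{13}=0,$$ and $\nu_{s-\hat\tau(s)}=\vartheta_{s-\hat\tau(s)}=0$ (resp. $s=\hat\tau(s)$). (Here, as for $r$, if $s=\sum_i x_i\otimes y_i$, then $s_{12}s_{13}=\sum x_ix_j\otimes y_i\otimes y_j$, $s_{13}s_{12}=\sum x_ix_j\otimes y_j\otimes y_i$, $s_{12}s_{23}=\sum x_i\otimes y_ix_j\otimes y_j$, $s_{23}s_{12}=\sum x_j\otimes x_iy_j\otimes y_i$, $s_{13}s_{23}=\sum x_i\otimes x_j\otimes y_iy_j$, $s_{23}s_{13}=\sum x_j\otimes x_i\otimes y_iy_j$ for whichever product is meant.) **Theorem.** $(A,\circ,*,\nu,\vartheta)$ is a completed DPP bialgebra. Let $\{e_j\}_{j\in\Omega}$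 be a basis of $B$ consisting of homogeneous elements, $\{f_j\}_{j\in\Omega}$ its dual basis, $\omega(f_i,e_j)=\delta_{ij}$, and for $r=\sum_i x_i\otimes y_i\in P\otimes P$ let $$\widehat r=\sum_i\sum_{j\in\Omega}(x_i\otimes e_j)\otimes(y_i\otimes f_j)\in A\hat\otimes A .$$ If $\Delta=\Delta_r$ and $\delta=\delta_r$, then $\nu=\nu_{\widehat r}$ and $\vartheta=\vartheta_{\widehat r}$. If $(P,\cdot,[-,-],\Delta,\delta)$ is coboundary (resp. quasi-triangular, triangular) associated with $r$, then $(A,\circ,*,\nu,\vartheta)$ is a coboundary (resp. quasi-triangular, triangular) completed DPP bialgebra associated with $\widehat r$. In particular, the induced completed DPP bialgebra is coboundary (resp. quasi-triangular, triangular) whenever the Poisson bialgebra is. -/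

import Mathlib

open scoped TensorProduct DirectSum

noncomputable section

namespace DPP

universe u v w

/-! ### Bilinear operations and the twists of tensor powers -/

section Ordinary

variable {k : Type u} [Field k]

/-- A bilinear operation `V ⊗ V → V`, curried: `m a b` is the product of `a` and `b`.
Left multiplication by `a` is `m a`, right multiplication by `a` is `m.flip a`. -/
abbrev Op (k : Type u) [Field k] (V : Type v) [AddCommGroup V] [Module k V] : Type v :=
  V →ₗ[k] V →ₗ[k] V

section Products

variable {X Y X' Y' Z : Type*}
  [AddCommGroup X] [Module k X] [AddCommGroup Y] [Module k Y]
  [AddCommGroup X'] [Module k X'] [AddCommGroup Y'] [Module k Y']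
  [AddCommGroup Z] [Module k Z]

/-- `(x ⊗ y, x' ⊗ y') ↦ m x x' ⊗ y ⊗ y'`. -/
def prod1213 (m : X →ₗ[k] X' →ₗ[k] Z) (r : X ⊗[k] Y) (s : X' ⊗[k] Y') : Z ⊗[k] (Y ⊗[k] Y') :=
  TensorProduct.map (TensorProduct.lift m) LinearMap.id
    (TensorProduct.tensorTensorTensorComm k X Y X' Y' (r ⊗ₜ[k] s))

/-- `(x ⊗ y, x' ⊗ y') ↦ x ⊗ m y x' ⊗ y'`. -/
def prod1223 (m : Y →ₗ[k] X' →ₗ[k] Z) (r : X ⊗[k] Y) (s : X' ⊗[k] Y') : X ⊗[k] (Z ⊗[k] Y') :=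
  LinearMap.lTensor X
    (LinearMap.rTensor Y' (TensorProduct.lift m) ∘ₗ (TensorProduct.assoc k Y X' Y').symm.toLinearMap)
    (TensorProduct.assoc k X Y (X' ⊗[k] Y') (r ⊗ₜ[k] s))

/-- `(x ⊗ y, x' ⊗ y') ↦ x ⊗ x' ⊗ m y y'`. -/
def prod1323 (m : Y →ₗ[k] Y' →ₗ[k] Z) (r : X ⊗[k] Y) (s : X' ⊗[k] Y') : X ⊗[k] (X' ⊗[k] Z) :=
  TensorProduct.assoc k X X' Z
    (TensorProduct.map LinearMap.id (TensorProduct.lift m)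
      (TensorProduct.tensorTensorTensorComm k X Y X' Y' (r ⊗ₜ[k] s)))

@[simp] theorem prod1213_tmul (m : X →ₗ[k] X' →ₗ[k] Z) (x : X) (y : Y) (x' : X') (y' : Y') :
    prod1213 m (x ⊗ₜ y) (x' ⊗ₜ y') = m x x' ⊗ₜ (y ⊗ₜ y') := rfl

@[simp] theorem prod1223_tmul (m : Y →ₗ[k] X' →ₗ[k] Z) (x : X) (y : Y) (x' : X') (y' : Y') :
    prod1223 m (x ⊗ₜ y) (x' ⊗ₜ y') = x ⊗ₜ (m y x' ⊗ₜ y') := rfl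

@[simp] theorem prod1323_tmul (m : Y →ₗ[k] Y' →ₗ[k] Z) (x : X) (y : Y) (x' : X') (y' : Y') :
    prod1323 m (x ⊗ₜ y) (x' ⊗ₜ y') = x ⊗ₜ (x' ⊗ₜ m y y') := rfl

end Products

/-! ### Poisson algebras, coalgebras and bialgebras -/

variable {P : Type v} [AddCommGroup P] [Module k P]

/-- The twist `τ : P ⊗ P → P ⊗ P`. -/
def tau (k : Type u) [Field k] (P : Type v) [AddCommGroup P] [Module k P] :
    P ⊗[k] P →ₗ[k] P ⊗[k] P :=
  (TensorProduct.comm k P P).toLinearMap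

/-- `τ ⊗ id` on `P ⊗ P ⊗ P`. -/
def tau12 (k : Type u) [Field k] (P : Type v) [AddCommGroup P] [Module k P] :
    P ⊗[k] (P ⊗[k] P) →ₗ[k] P ⊗[k] (P ⊗[k] P) :=
  (TensorProduct.leftComm k P P P).toLinearMap

/-- `(f ⊗ id) ∘ g : P → P ⊗ P ⊗ P` for `f, g : P → P ⊗ P`. -/
def coL (f g : P →ₗ[k] P ⊗[k] P) : P →ₗ[k] P ⊗[k] (P ⊗[k] P) :=
  (TensorProduct.assoc k P P P).toLinearMap ∘ₗ LinearMap.rTensor P f ∘ₗ g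

/-- `(id ⊗ f) ∘ g : P → P ⊗ P ⊗ P` for `f, g : P → P ⊗ P`. -/
def coR (f g : P →ₗ[k] P ⊗[k] P) : P →ₗ[k] P ⊗[k] (P ⊗[k] P) :=
  LinearMap.lTensor P f ∘ₗ g

/-- Poisson algebra `(P, ·, [-,-])`: a commutative associative product (not necessarily unital)
and a Lie bracket such that `[a, -]` is a derivation of the product. -/
structure IsPoissonAlgebra (mul br : Op k P) : Prop where
  mul_comm : ∀ a b, mul a b = mul b a
  mul_assoc : ∀ a b c, mul a (mul b c) = mul (mul a b) c
  br_skew : ∀ a b, br a b = -br b a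
  jacobi : ∀ a b c, br a (br b c) + br b (br c a) + br c (br a b) = 0
  leibniz : ∀ a b c, br a (mul b c) = mul (br a b) c + mul b (br a c)

/-- Poisson coalgebra `(P, Δ, δ)`. -/
structure IsPoissonCoalgebra (Δ δ : P →ₗ[k] P ⊗[k] P) : Prop where
  cocomm : tau k P ∘ₗ Δ = Δ
  coassoc : coL Δ Δ = coR Δ Δ
  coskew : tau k P ∘ₗ δ = -δ
  cojacobi : coR δ δ - tau12 k P ∘ₗ coR δ δ = coL δ δ
  coleibniz : coR Δ δ = coL δ Δ + tau12 k P ∘ₗ coR δ Δ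

/-- `f ⊗ id` acting on `P ⊗ P`. -/
abbrev actL (f : P →ₗ[k] P) : P ⊗[k] P →ₗ[k] P ⊗[k] P := LinearMap.rTensor P f

/-- `id ⊗ f` acting on `P ⊗ P`. -/
abbrev actR (f : P →ₗ[k] P) : P ⊗[k] P →ₗ[k] P ⊗[k] P := LinearMap.lTensor P f

/-- Poisson bialgebra `(P, ·, [-,-], Δ, δ)`. -/
structure IsPoissonBialgebra (mul br : Op k P) (Δ δ : P →ₗ[k] P ⊗[k] P) : Prop where
  alg : IsPoissonAlgebra mul br
  coalg : IsPoissonCoalgebra Δ δ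
  infinitesimal : ∀ a b, Δ (mul a b) = actL (mul b) (Δ a) + actR (mul a) (Δ b)
  lieBialg : ∀ a b, δ (br a b) =
    (actL (br a) (δ b) + actR (br a) (δ b)) - (actL (br b) (δ a) + actR (br b) (δ a))
  compat₁ : ∀ a b, Δ (br a b) =
    (actL (br a) (Δ b) + actR (br a) (Δ b)) + (actL (mul b) (δ a) - actR (mul b) (δ a))
  compat₂ : ∀ a b, δ (mul a b) =
    actL (mul a) (δ b) + actL (mul b) (δ a) + actR (br a) (Δ b) + actR (br b) (Δ a)

/-- `Δ_r(p) = (id ⊗ u(p) - u(p) ⊗ id)(r)`, with `u(p)` the multiplication by `p`. -/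
def cobDelta (mul : Op k P) (r : P ⊗[k] P) (p : P) : P ⊗[k] P :=
  actR (mul p) r - actL (mul p) r

/-- `δ_r(p) = (id ⊗ ad(p) + ad(p) ⊗ id)(r)`. -/
def cobdelta (br : Op k P) (r : P ⊗[k] P) (p : P) : P ⊗[k] P :=
  actR (br p) r + actL (br p) r

/-- `r` is Poi-invariant. -/
def IsPoiInvariant (mul br : Op k P) (r : P ⊗[k] P) : Prop :=
  ∀ p, cobDelta mul r p = 0 ∧ cobdelta br r p = 0

/-- `r` is a solution of the Poisson Yang-Baxter equation:
`r₁₂ r₁₃ + r₁₃ r₂₃ - r₂₃ r₁₂ = 0` and `[r₁₂, r₁₃] + [r₁₃, r₂₃] + [r₁₂, r₂₃] = 0`.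
Here `r₂₃ r₁₂ = ∑ xⱼ ⊗ (xᵢ yⱼ) ⊗ yᵢ`, which is `prod1223` for the opposite product. -/
structure IsPoiYBESolution (mul br : Op k P) (r : P ⊗[k] P) : Prop where
  assocYBE : prod1213 mul r r + prod1323 mul r r - prod1223 mul.flip r r = 0
  classicalYBE : prod1213 br r r + prod1323 br r r + prod1223 br r r = 0

/-- `(P, ·, [-,-], Δ, δ)` is a coboundary Poisson bialgebra, with `Δ = Δ_r` and `δ = δ_r`. -/
structure IsCoboundaryPoisson (mul br : Op k P) (Δ δ : P →ₗ[k] P ⊗[k] P) (r : P ⊗[k] P) :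
    Prop where
  bialg : IsPoissonBialgebra mul br Δ δ
  Delta_eq : ∀ p, Δ p = cobDelta mul r p
  delta_eq : ∀ p, δ p = cobdelta br r p

/-- Quasi-triangular Poisson bialgebra associated with `r`. -/
structure IsQuasiTriangularPoisson (mul br : Op k P) (Δ δ : P →ₗ[k] P ⊗[k] P) (r : P ⊗[k] P) :
    Prop extends IsCoboundaryPoisson mul br Δ δ r where
  ybe : IsPoiYBESolution mul br r
  invariant : IsPoiInvariant mul br (r + tau k P r)

/-- Triangular Poisson bialgebra associated with `r`. -/
structure IsTriangularPoisson (mul br : Op k P) (Δ δ : P →ₗ[k] P ⊗[k] P) (r : P ⊗[k] P) :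
    Prop extends IsCoboundaryPoisson mul br Δ δ r where
  ybe : IsPoiYBESolution mul br r
  skew : r = -tau k P r

/-! ### Perm, Leibniz and dual pre-Poisson algebras -/

/-- (Left) perm algebra. -/
structure IsPerm (m : Op k P) : Prop where
  assoc : ∀ a b c, m a (m b c) = m (m a b) c
  perm : ∀ a b c, m (m a b) c = m (m b a) c

/-- (Left) Leibniz algebra. -/
def IsLeibniz (m : Op k P) : Prop :=
  ∀ a b c, m a (m b c) = m (m a b) c + m b (m a c)

/-- Dual pre-Poisson algebra `(A, ∘, ∗)`. -/
structure IsDPPAlgebra (circ ast : Op k P) : Prop where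
  perm : IsPerm circ
  leib : IsLeibniz ast
  compat₁ : ∀ a b c, ast (circ a b) c = circ a (ast b c) + circ b (ast a c)
  compat₂ : ∀ a b c, circ (ast a b) c = ast a (circ b c) - circ b (ast a c)
  compat₃ : ∀ a b c, circ (ast a b) c = -circ (ast b a) c

end Ordinary

/-! ### Graded spaces and completed tensor products

A `ℤ`-graded vector space is given by its homogeneous pieces `A i`; the space itself is
`⨁ i, A i`. -/

section Graded

variable {k : Type u} [Field k]
variable {A : ℤ → Type v} [∀ i, AddCommGroup (A i)] [∀ i, Module k (A i)]

/-- The inclusion of a homogeneous piece. -/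
abbrev inc (k : Type u) [Field k] (A : ℤ → Type v) [∀ i, AddCommGroup (A i)]
    [∀ i, Module k (A i)] (i : ℤ) : A i →ₗ[k] ⨁ i, A i :=
  DirectSum.lof k ℤ A i

/-- The projection to a homogeneous piece. -/
abbrev proj (k : Type u) [Field k] (A : ℤ → Type v) [∀ i, AddCommGroup (A i)]
    [∀ i, Module k (A i)] (i : ℤ) : (⨁ i, A i) →ₗ[k] A i :=
  DirectSum.component k ℤ A i

/-- `A_i m A_j ⊆ A_{i+j}`. -/
def IsGradedOp (m : Op k (⨁ i, A i)) : Prop :=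
  ∀ (i j : ℤ) (x : A i) (y : A j), ∃ z : A (i + j), m (inc k A i x) (inc k A j y) = inc k A (i + j) z

/-- The completed tensor square `A ⊗̂ A = ∏_{i,j} A_i ⊗ A_j`. -/
abbrev CTwo (k : Type u) [Field k] (A : ℤ → Type v) [∀ i, AddCommGroup (A i)]
    [∀ i, Module k (A i)] : Type v :=
  (i j : ℤ) → A i ⊗[k] A j

/-- The completed tensor cube `A ⊗̂ A ⊗̂ A = ∏_{i,j,l} A_i ⊗ A_j ⊗ A_l`. -/
abbrev CThree (k : Type u) [Field k] (A : ℤ → Type v) [∀ i, AddCommGroup (A i)]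
    [∀ i, Module k (A i)] : Type v :=
  (i j l : ℤ) → A i ⊗[k] (A j ⊗[k] A l)

/-- A family in `A ⊗̂ A ⊗̂ A` whose formal sum is well defined: in each multidegree only
finitely many members are nonzero. -/
def Summable3 {ι : Type*} (F : ι → CThree k A) : Prop :=
  ∀ a b c, {s | F s a b c ≠ 0}.Finite

/-- The formal sum of a family in `A ⊗̂ A ⊗̂ A` (meaningful when `Summable3 F`). -/
def formalSum {ι : Type*} (F : ι → CThree k A) : CThree k A :=
  fun a b c => ∑ᶠ s, F s a b c

/-- The completed twist `τ̂`. -/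
def hatTau : CTwo k A →ₗ[k] CTwo k A where
  toFun X := fun i j => TensorProduct.comm k (A j) (A i) (X j i)
  map_add' _ _ := by ext; simp
  map_smul' _ _ := by ext; simp

/-- `τ̂ ⊗̂ id` on `A ⊗̂ A ⊗̂ A`. -/
def hatTau12 (Y : CThree k A) : CThree k A :=
  fun a b c => TensorProduct.leftComm k (A b) (A a) (A c) (Y b a c)

/-- `f ⊗̂ id` on `A ⊗̂ A`. It is only applied to left and right multiplications of a graded
algebra, for which the sum in each bidegree is finite. -/
def hatL (f : (⨁ i, A i) →ₗ[k] ⨁ i, A i) (X : CTwo k A) : CTwo k A :=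
  fun a b => ∑ᶠ i, LinearMap.rTensor (A b) (proj k A a ∘ₗ f ∘ₗ inc k A i) (X i b)

/-- `id ⊗̂ f` on `A ⊗̂ A`; see `hatL`. -/
def hatR (f : (⨁ i, A i) →ₗ[k] ⨁ i, A i) (X : CTwo k A) : CTwo k A :=
  fun a b => ∑ᶠ j, LinearMap.lTensor (A a) (proj k A b ∘ₗ f ∘ₗ inc k A j) (X a j)

/-- The component `A_i → A_a ⊗ A_b` of a completed comultiplication. -/
def blockCo (ν : (⨁ i, A i) →ₗ[k] CTwo k A) (a b i : ℤ) : A i →ₗ[k] A a ⊗[k] A b :=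
  LinearMap.proj b ∘ₗ LinearMap.proj a ∘ₗ ν ∘ₗ inc k A i

/-- The family, indexed by the degree `i` of the first tensor factor of `μ(v)`, whose formal sum
is `(ν ⊗̂ id) μ(v)`. -/
def coLFamily (ν μ : (⨁ i, A i) →ₗ[k] CTwo k A) (v : ⨁ i, A i) (i : ℤ) : CThree k A :=
  fun a b c => TensorProduct.assoc k (A a) (A b) (A c)
    (LinearMap.rTensor (A c) (blockCo ν a b i) (μ v i c))

/-- The family, indexed by the degree `j` of the second tensor factor of `μ(v)`, whose formal sum
is `(id ⊗̂ ν) μ(v)`. -/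
def coRFamily (ν μ : (⨁ i, A i) →ₗ[k] CTwo k A) (v : ⨁ i, A i) (j : ℤ) : CThree k A :=
  fun a b c => LinearMap.lTensor (A a) (blockCo ν b c j) (μ v a j)

/-- Both `(ν ⊗̂ id) μ` and `(id ⊗̂ ν) μ` are well defined. -/
def Composable (ν μ : (⨁ i, A i) →ₗ[k] CTwo k A) : Prop :=
  ∀ v, Summable3 (coLFamily ν μ v) ∧ Summable3 (coRFamily ν μ v)

/-- `(ν ⊗̂ id) μ(v)`. -/
def hatCoL (ν μ : (⨁ i, A i) →ₗ[k] CTwo k A) (v : ⨁ i, A i) : CThree k A :=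
  formalSum (coLFamily ν μ v)

/-- `(id ⊗̂ ν) μ(v)`. -/
def hatCoR (ν μ : (⨁ i, A i) →ₗ[k] CTwo k A) (v : ⨁ i, A i) : CThree k A :=
  formalSum (coRFamily ν μ v)

/-! ### Completed dual pre-Poisson coalgebras and bialgebras -/

/-- Completed perm coalgebra. -/
structure IsCompletedPermCoalgebra (ν : (⨁ i, A i) →ₗ[k] CTwo k A) : Prop where
  composable : Composable ν ν
  coassoc : ∀ v, hatCoL ν ν v = hatCoR ν ν v
  coperm : ∀ v, hatCoL ν ν v = hatTau12 (hatCoL ν ν v)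

/-- Completed (left) Leibniz coalgebra: the identity dual to
`a ∗ (b ∗ c) = (a ∗ b) ∗ c + b ∗ (a ∗ c)`. -/
structure IsCompletedLeibnizCoalgebra (θ : (⨁ i, A i) →ₗ[k] CTwo k A) : Prop where
  composable : Composable θ θ
  coleibniz : ∀ v, hatCoR θ θ v = hatCoL θ θ v + hatTau12 (hatCoR θ θ v)

/-- Completed dual pre-Poisson coalgebra. -/
structure IsCompletedDPPCoalgebra (ν θ : (⨁ i, A i) →ₗ[k] CTwo k A) : Prop where
  perm : IsCompletedPermCoalgebra ν
  leib : IsCompletedLeibnizCoalgebra θ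
  composable₁ : Composable ν θ
  composable₂ : Composable θ ν
  compat₁ : ∀ v, hatCoR ν θ v = hatCoL θ ν v + hatTau12 (hatCoR θ ν v)
  compat₂ : ∀ v, hatCoL ν θ v = hatCoR θ ν v + hatTau12 (hatCoR θ ν v)
  compat₃ : ∀ v, hatCoL θ ν v = -hatTau12 (hatCoL θ ν v)

/-- `ℤ`-graded perm algebra (with finite-dimensional pieces). -/
structure IsGradedPerm (circ : Op k (⨁ i, A i)) : Prop where
  finite : ∀ i, Module.Finite k (A i)
  perm : IsPerm circ
  graded : IsGradedOp circ

/-- `ℤ`-graded dual pre-Poisson algebra (with finite-dimensional pieces). -/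
structure IsGradedDPPAlgebra (circ ast : Op k (⨁ i, A i)) : Prop where
  finite : ∀ i, Module.Finite k (A i)
  alg : IsDPPAlgebra circ ast
  graded_circ : IsGradedOp circ
  graded_ast : IsGradedOp ast

/-- The compatibility conditions of a completed perm bialgebra `(A, ∘, ν)`. -/
structure PermBialgebraCompat (circ : Op k (⨁ i, A i)) (ν : (⨁ i, A i) →ₗ[k] CTwo k A) :
    Prop where
  compat₁ : ∀ a b, hatL (circ.flip a) (ν b) = hatTau (hatL (circ.flip b) (ν a))
  compat₂ : ∀ a b, ν (circ a b) = hatL (circ a - circ.flip a) (ν b) + hatR (circ.flip b) (ν a)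
  compat₃ : ∀ a b, ν (circ a b) =
    hatR (circ a) (ν b) + hatL (circ b - circ.flip b) (ν a - hatTau (ν a))

/-- The compatibility conditions of a completed Leibniz bialgebra `(A, ∗, ϑ)`. -/
structure LeibnizBialgebraCompat (ast : Op k (⨁ i, A i)) (θ : (⨁ i, A i) →ₗ[k] CTwo k A) :
    Prop where
  compat₁ : ∀ a b, hatTau (hatL (ast.flip b) (θ a)) = hatL (ast.flip a) (θ b)
  compat₂ : ∀ a b, θ (ast a b) =
    (hatR (ast.flip b) (θ a + hatTau (θ a)) - hatL (ast b + ast.flip b) (θ a + hatTau (θ a)))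
      + (hatR (ast a) (θ b) + hatL (ast a) (θ b))

/-- Completed dual pre-Poisson bialgebra `(A, ∘, ∗, ν, ϑ)`. -/
structure IsCompletedDPPBialgebra (circ ast : Op k (⨁ i, A i))
    (ν θ : (⨁ i, A i) →ₗ[k] CTwo k A) : Prop where
  alg : IsGradedDPPAlgebra circ ast
  coalg : IsCompletedDPPCoalgebra ν θ
  permBialg : PermBialgebraCompat circ ν
  leibBialg : LeibnizBialgebraCompat ast θ
  compat₁ : ∀ a b, ν (ast a b) =
    (hatR (ast a) (ν b) + hatL (ast a) (ν b))
      + (hatL (circ b - circ.flip b) (θ a + hatTau (θ a))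
        - hatR (circ.flip b) (θ a + hatTau (θ a)))
  compat₂ : ∀ a b, θ (circ a b) =
    hatR (circ a) (θ b) + hatR (circ.flip b) (θ a) - hatL (ast a + ast.flip a) (ν b)
      - hatL (ast b + ast.flip b) (ν a - hatTau (ν a))
  compat₃ : ∀ a b, hatR (ast.flip a) (hatTau (ν b)) = -hatL (circ.flip b) (θ a)
  compat₄ : ∀ a b, ν (ast a b) =
    (hatR (circ a) (θ b) - hatL (circ a) (θ b))
      + (hatR (ast.flip b) (ν a - hatTau (ν a))
        - hatL (ast b + ast.flip b) (ν a - hatTau (ν a)))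
  compat₅ : ∀ a b, θ (circ a b) + hatTau (θ (circ a b)) =
    hatR (circ a) (θ b + hatTau (θ b)) + hatR (circ b) (θ a + hatTau (θ a))
      - hatL (ast a) (ν b - hatTau (ν b)) - hatL (ast b) (ν a - hatTau (ν a))
  compat₆ : ∀ a b, θ (circ a b) =
    hatL (circ a) (θ b) - hatR (ast.flip b) (ν a - hatTau (ν a))
      + hatR (ast a) (ν b) + hatL (circ b - circ.flip b) (θ a + hatTau (θ a))
  compat₇ : ∀ a b, ν (ast a b + ast b a) =
    hatR (ast a + ast.flip a) (ν b) + hatL (ast a + ast.flip a) (hatTau (ν b))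
      + hatR (circ b - circ.flip b) (θ a) + hatL (circ b - circ.flip b) (hatTau (θ a))

/-! ### The completed dual pre-Poisson Yang-Baxter equation -/

/-- The component `A_i ⊗ A_j → A_c` of a bilinear operation. -/
def blockOp (m : Op k (⨁ i, A i)) (c i j : ℤ) : A i →ₗ[k] A j →ₗ[k] A c :=
  (m.compl₁₂ (inc k A i) (inc k A j)).compr₂ (proj k A c)

/-- The family with formal sum `∑ m x_i x_j ⊗ y_i ⊗ y_j` for `r = ∑ x_i ⊗ y_i`, indexed by the
degrees of the two factors that are multiplied. -/
def family1213 (m : Op k (⨁ i, A i)) (r : CTwo k A) (s : ℤ × ℤ) : CThree k A :=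
  fun a b c => prod1213 (blockOp m a s.1 s.2) (r s.1 b) (r s.2 c)

/-- The family with formal sum `∑ x_i ⊗ m y_i x_j ⊗ y_j`. -/
def family1223 (m : Op k (⨁ i, A i)) (r : CTwo k A) (s : ℤ × ℤ) : CThree k A :=
  fun a b c => prod1223 (blockOp m b s.1 s.2) (r a s.1) (r s.2 c)

/-- The family with formal sum `∑ x_i ⊗ x_j ⊗ m y_i y_j`. -/
def family1323 (m : Op k (⨁ i, A i)) (r : CTwo k A) (s : ℤ × ℤ) : CThree k A :=
  fun a b c => prod1323 (blockOp m c s.1 s.2) (r a s.1) (r b s.2)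

/-- `r` is a completed solution of the dual pre-Poisson Yang-Baxter equation: all the products
below are well defined in `A ⊗̂ A ⊗̂ A`, and
`r₁₂ ∘ r₂₃ - r₁₃ ∘ r₂₃ + r₁₂ ∘ r₁₃ - r₁₃ ∘ r₁₂ = 0`,
`r₁₂ ∗ r₁₃ - r₁₂ ∗ r₂₃ - r₂₃ ∗ r₁₂ + r₂₃ ∗ r₁₃ = 0`.
Products in the reversed order are those in the usual order for the opposite operation:
`r₁₃ ∘ r₁₂ = ∑ (x_i ∘ x_j) ⊗ y_j ⊗ y_i`, `r₂₃ ∗ r₁₂ = ∑ x_j ⊗ (x_i ∗ y_j) ⊗ y_i`,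
`r₂₃ ∗ r₁₃ = ∑ x_j ⊗ x_i ⊗ (y_i ∗ y_j)`. -/
structure IsCompletedDPYBESolution (circ ast : Op k (⨁ i, A i)) (r : CTwo k A) : Prop where
  summable_circ : Summable3 (family1223 circ r) ∧ Summable3 (family1323 circ r) ∧
    Summable3 (family1213 circ r) ∧ Summable3 (family1213 circ.flip r)
  summable_ast : Summable3 (family1213 ast r) ∧ Summable3 (family1223 ast r) ∧
    Summable3 (family1223 ast.flip r) ∧ Summable3 (family1323 ast.flip r)
  permYBE : formalSum (family1223 circ r) - formalSum (family1323 circ r)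
    + formalSum (family1213 circ r) - formalSum (family1213 circ.flip r) = 0
  leibYBE : formalSum (family1213 ast r) - formalSum (family1223 ast r)
    - formalSum (family1223 ast.flip r) + formalSum (family1323 ast.flip r) = 0

/-- `ν_r(a) = (id ⊗̂ R_∘(a) + (R_∘ - L_∘)(a) ⊗̂ id)(r)`. -/
def cobNu (circ : Op k (⨁ i, A i)) (r : CTwo k A) (a : ⨁ i, A i) : CTwo k A :=
  hatR (circ.flip a) r + hatL (circ.flip a - circ a) r

/-- `ϑ_r(a) = ((L_∗ + R_∗)(a) ⊗̂ id - id ⊗̂ R_∗(a))(r)`. -/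
def cobTheta (ast : Op k (⨁ i, A i)) (r : CTwo k A) (a : ⨁ i, A i) : CTwo k A :=
  hatL (ast a + ast.flip a) r - hatR (ast.flip a) r

/-- `r` is DP-invariant. -/
def IsDPInvariant (circ ast : Op k (⨁ i, A i)) (r : CTwo k A) : Prop :=
  ∀ a, cobTheta ast r a = 0 ∧ cobNu circ r a = 0

/-- Coboundary completed DPP bialgebra, with `ν = ν_r` and `ϑ = ϑ_r`. -/
structure IsCoboundaryDPP (circ ast : Op k (⨁ i, A i)) (ν θ : (⨁ i, A i) →ₗ[k] CTwo k A)
    (r : CTwo k A) : Prop where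
  bialg : IsCompletedDPPBialgebra circ ast ν θ
  nu_eq : ∀ a, ν a = cobNu circ r a
  theta_eq : ∀ a, θ a = cobTheta ast r a

/-- Quasi-triangular completed DPP bialgebra associated with `r`. -/
structure IsQuasiTriangularDPP (circ ast : Op k (⨁ i, A i)) (ν θ : (⨁ i, A i) →ₗ[k] CTwo k A)
    (r : CTwo k A) : Prop extends IsCoboundaryDPP circ ast ν θ r where
  ybe : IsCompletedDPYBESolution circ ast r
  invariant : IsDPInvariant circ ast (r - hatTau r)

/-- Triangular completed DPP bialgebra associated with `r`. -/
structure IsTriangularDPP (circ ast : Op k (⨁ i, A i)) (ν θ : (⨁ i, A i) →ₗ[k] CTwo k A)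
    (r : CTwo k A) : Prop extends IsCoboundaryDPP circ ast ν θ r where
  ybe : IsCompletedDPYBESolution circ ast r
  symm : r = hatTau r

end Graded

/-! ### Quadratic graded perm algebras and their completed comultiplication -/

section Quadratic

variable {k : Type u} [Field k]
variable {B : ℤ → Type v} [∀ i, AddCommGroup (B i)] [∀ i, Module k (B i)]

/-- Quadratic `ℤ`-graded perm algebra `(B, ∘, ω)`. -/
structure IsQuadraticPerm (circ : Op k (⨁ i, B i)) (ω : (⨁ i, B i) →ₗ[k] (⨁ i, B i) →ₗ[k] k) :
    Prop where
  alg : IsGradedPerm circ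
  skew : ∀ a b, ω a b = -ω b a
  invariant : ∀ a b c, ω (circ a b) c = ω a (circ b c - circ c b)
  nondeg : ∀ a, (∀ b, ω a b = 0) → a = 0
  graded : ∃ m : ℤ, ∀ i j : ℤ, i + j + m ≠ 0 →
    ∀ (x : B i) (y : B j), ω (inc k B i x) (inc k B j y) = 0

/-- The linear form `x ⊗ y ↦ ω(x, s) ω(y, t)` on `B_i ⊗ B_j`. -/
def pairBlock (ω : (⨁ i, B i) →ₗ[k] (⨁ i, B i) →ₗ[k] k) (s t : ⨁ i, B i) (i j : ℤ) :
    B i ⊗[k] B j →ₗ[k] k :=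
  LinearMap.mul' k k ∘ₗ
    TensorProduct.map (ω.flip s ∘ₗ inc k B i) (ω.flip t ∘ₗ inc k B j)

/-- `ω̂(X, s ⊗ t)` for `X ∈ B ⊗̂ B`; the sum is finite because `ω` is graded. -/
def omegaHat (ω : (⨁ i, B i) →ₗ[k] (⨁ i, B i) →ₗ[k] k) (X : CTwo k B) (s t : ⨁ i, B i) : k :=
  ∑ᶠ ij : ℤ × ℤ, pairBlock ω s t ij.1 ij.2 (X ij.1 ij.2)


section Existence

variable {circ : Op k (⨁ i, B i)} {ω : (⨁ i, B i) →ₗ[k] (⨁ i, B i) →ₗ[k] k}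

/-- `ω` as a map from `B_i` to the dual of `B_j`. -/
def omegaDual (ω : (⨁ i, B i) →ₗ[k] (⨁ i, B i) →ₗ[k] k) (i j : ℤ) : B i →ₗ[k] Module.Dual k (B j) :=
  ω.compl₁₂ (inc k B i) (inc k B j)

theorem omegaDual_injective (h : IsQuadraticPerm circ ω) {m : ℤ}
    (hm : ∀ i j : ℤ, i + j + m ≠ 0 → ∀ (x : B i) (y : B j), ω (inc k B i x) (inc k B j y) = 0)
    {i j : ℤ} (hij : i + j + m = 0) : Function.Injective (omegaDual ω i j) := by
  rw [injective_iff_map_eq_zero]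
  intro x hx
  have h0 : inc k B i x = 0 := by
    apply h.nondeg
    intro b
    induction b using DirectSum.induction_on with
    | zero => simp
    | of l y =>
      by_cases hl : i + l + m = 0
      · obtain rfl : l = j := by omega
        exact LinearMap.congr_fun hx y
      · exact hm i l hl x y
    | add a b ha hb => rw [map_add, ha, hb, add_zero]
  exact DirectSum.of_injective (β := B) i (by simpa [DirectSum.lof_eq_of] using h0)

theorem omegaDual_bijective (h : IsQuadraticPerm circ ω) {m : ℤ}
    (hm : ∀ i j : ℤ, i + j + m ≠ 0 → ∀ (x : B i) (y : B j), ω (inc k B i x) (inc k B j y) = 0)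
    {i j : ℤ} (hij : i + j + m = 0) : Function.Bijective (omegaDual ω i j) := by
  have := h.alg.finite
  have h1 := omegaDual_injective h hm hij
  have h2 := omegaDual_injective h hm (i := j) (j := i) (by omega)
  have e1 := LinearMap.finrank_le_finrank_of_injective h1
  have e2 := LinearMap.finrank_le_finrank_of_injective h2
  rw [Subspace.dual_finrank_eq] at e1 e2
  refine ⟨h1, (LinearMap.injective_iff_surjective_of_finrank_eq_finrank ?_).1 h1⟩
  rw [Subspace.dual_finrank_eq]
  omega

theorem pairBlock_inc {i' j' : ℤ} (s : B i') (t : B j') (i j : ℤ) (X : B i ⊗[k] B j) :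
    pairBlock ω (inc k B i' s) (inc k B j' t) i j X =
      TensorProduct.dualDistrib k (B i') (B j')
        (TensorProduct.map (omegaDual ω i i') (omegaDual ω j j') X) (s ⊗ₜ t) := by
  induction X using TensorProduct.induction_on with
  | zero => simp
  | tmul x y => rfl
  | add x y hx hy => simp only [map_add, hx, hy, LinearMap.add_apply]

/-- `ω` has degree `-m`: it pairs `B_i` with `B_{-m-i}` only. -/
def OmegaDegree (ω : (⨁ i, B i) →ₗ[k] (⨁ i, B i) →ₗ[k] k) (m : ℤ) : Prop :=
  ∀ i j : ℤ, i + j + m ≠ 0 → ∀ (x : B i) (y : B j), ω (inc k B i x) (inc k B j y) = 0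

theorem pairBlock_eq_zero {m : ℤ} (hm : OmegaDegree ω m) {i j i' j' : ℤ}
    (s : B i') (t : B j') (X : B i ⊗[k] B j) (hne : ¬ (i + i' + m = 0 ∧ j + j' + m = 0)) :
    pairBlock ω (inc k B i' s) (inc k B j' t) i j X = 0 := by
  induction X using TensorProduct.induction_on with
  | zero => simp
  | tmul x y =>
    change ω (inc k B i x) (inc k B i' s) * ω (inc k B j y) (inc k B j' t) = 0
    by_cases h1 : i + i' + m = 0
    · rw [hm j j' (fun h2 => hne ⟨h1, h2⟩), mul_zero]
    · rw [hm i i' h1, zero_mul]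
  | add x y hx hy => rw [map_add, hx, hy, add_zero]

theorem pairBlock_add_left (s s' t : ⨁ i, B i) (i j : ℤ) (X : B i ⊗[k] B j) :
    pairBlock ω (s + s') t i j X = pairBlock ω s t i j X + pairBlock ω s' t i j X := by
  simp [pairBlock, LinearMap.add_comp, TensorProduct.map_add_left]

theorem pairBlock_add_right (s t t' : ⨁ i, B i) (i j : ℤ) (X : B i ⊗[k] B j) :
    pairBlock ω s (t + t') i j X = pairBlock ω s t i j X + pairBlock ω s t' i j X := by
  simp [pairBlock, LinearMap.add_comp, TensorProduct.map_add_right]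

theorem pairBlock_finite {m : ℤ} (hm : OmegaDegree ω m) (X : CTwo k B) (s t : ⨁ i, B i) :
    (Function.support fun ij : ℤ × ℤ => pairBlock ω s t ij.1 ij.2 (X ij.1 ij.2)).Finite := by
  induction s using DirectSum.induction_on with
  | zero => simp [pairBlock, Function.support]
  | of i' s =>
    induction t using DirectSum.induction_on with
    | zero => simp [pairBlock, Function.support]
    | of j' t =>
      refine (Set.finite_singleton (-m - i', -m - j')).subset ?_
      intro ij hij
      by_contra hne
      refine hij (pairBlock_eq_zero hm s t _ ?_)
      rintro ⟨h1, h2⟩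
      exact hne (Prod.ext (by simp; omega) (by simp; omega))
    | add t t' ht ht' =>
      refine (ht.union ht').subset ?_
      simp only [pairBlock_add_right]
      exact Function.support_add _ _
  | add s s' hs hs' =>
    refine (hs.union hs').subset ?_
    simp only [pairBlock_add_left]
    exact Function.support_add _ _

theorem omegaHat_inc {m : ℤ} (hm : OmegaDegree ω m) (X : CTwo k B) {i j i' j' : ℤ}
    (hi : i + i' + m = 0) (hj : j + j' + m = 0) (s : B i') (t : B j') :
    omegaHat ω X (inc k B i' s) (inc k B j' t) =
      TensorProduct.dualDistrib k (B i') (B j')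
        (TensorProduct.map (omegaDual ω i i') (omegaDual ω j j') (X i j)) (s ⊗ₜ t) := by
  rw [← pairBlock_inc]
  refine finsum_eq_single _ (i, j) ?_
  intro ij hij
  refine pairBlock_eq_zero hm s t _ ?_
  rintro ⟨h1, h2⟩
  exact hij (Prod.ext (by simp; omega) (by simp; omega))

theorem pairing_bijective (h : IsQuadraticPerm circ ω) {m : ℤ} (hm : OmegaDegree ω m)
    {i j i' j' : ℤ} (hi : i + i' + m = 0) (hj : j + j' + m = 0) :
    Function.Bijective (TensorProduct.dualDistrib k (B i') (B j') ∘ₗ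
      TensorProduct.map (omegaDual ω i i') (omegaDual ω j j')) := by
  have := h.alg.finite
  let e := TensorProduct.congr
    (LinearEquiv.ofBijective _ (omegaDual_bijective h hm hi))
    (LinearEquiv.ofBijective _ (omegaDual_bijective h hm hj)) ≪≫ₗ
    TensorProduct.dualDistribEquiv k (B i') (B j')
  exact e.bijective

/-- The comultiplication dual to the product with respect to `ω` exists and is unique. -/
theorem existsUnique_coproduct (h : IsQuadraticPerm circ ω) :
    ∃! ν : (⨁ i, B i) →ₗ[k] CTwo k B,
      ∀ b s t, omegaHat ω (ν b) s t = -ω b (circ s t) := by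
  obtain ⟨m, hm'⟩ := h.graded
  have hm : OmegaDegree ω m := hm'
  have hbij := fun i j : ℤ => pairing_bijective h hm (i := i) (j := j) (i' := -m - i)
    (j' := -m - j) (by omega) (by omega)
  let E := fun i j : ℤ => LinearEquiv.ofBijective _ (hbij i j)
  let φ : ∀ i j : ℤ, (⨁ i, B i) →ₗ[k] Module.Dual k (B i ⊗[k] B j) := fun i j =>
    -(LinearMap.lcomp k k (TensorProduct.lift (circ.compl₁₂ (inc k B i) (inc k B j))) ∘ₗ ω)
  let ν : (⨁ i, B i) →ₗ[k] CTwo k B := LinearMap.pi fun i => LinearMap.pi fun j =>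
    (E i j).symm.toLinearMap ∘ₗ φ (-m - i) (-m - j)
  have key : ∀ b s t, omegaHat ω (ν b) s t = -ω b (circ s t) := by
    intro b s t
    induction s using DirectSum.induction_on with
    | zero => simp [omegaHat, pairBlock]
    | of i' s =>
      induction t using DirectSum.induction_on with
      | zero => simp [omegaHat, pairBlock]
      | of j' t =>
        obtain ⟨i, rfl⟩ : ∃ i, i' = -m - i := ⟨-m - i', by omega⟩
        obtain ⟨j, rfl⟩ : ∃ j, j' = -m - j := ⟨-m - j', by omega⟩
        refine (omegaHat_inc hm (ν b) (i := i) (j := j) (by omega) (by omega) s t).trans ?_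
        exact LinearMap.congr_fun ((E i j).apply_symm_apply (φ (-m - i) (-m - j) b)) (s ⊗ₜ t)
      | add t t' ht ht' =>
        rw [map_add, map_add, neg_add, ← ht, ← ht', omegaHat]
        simp only [pairBlock_add_right]
        exact finsum_add_distrib (pairBlock_finite hm _ _ _) (pairBlock_finite hm _ _ _)
    | add s s' hs hs' =>
      rw [map_add, LinearMap.add_apply, map_add, neg_add, ← hs, ← hs', omegaHat]
      simp only [pairBlock_add_left]
      exact finsum_add_distrib (pairBlock_finite hm _ _ _) (pairBlock_finite hm _ _ _)
  refine ⟨ν, key, ?_⟩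
  intro ν' hν'
  refine LinearMap.ext fun b => ?_
  funext i j
  apply (hbij i j).1
  refine TensorProduct.ext' fun s t => ?_
  have h1 := omegaHat_inc hm (ν' b) (i := i) (j := j) (i' := -m - i) (j' := -m - j)
    (by omega) (by omega) s t
  have h2 := omegaHat_inc hm (ν b) (i := i) (j := j) (i' := -m - i) (j' := -m - j)
    (by omega) (by omega) s t
  rw [hν'] at h1
  rw [key] at h2
  exact h1.symm.trans h2

end Existence

/-- The completed comultiplication `ν_ω : B → B ⊗̂ B`, determined by
`ω̂(ν_ω(b), s ⊗ t) = -ω(b, s ∘ t)`. -/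
def nuOmega {circ : Op k (⨁ i, B i)} {ω : (⨁ i, B i) →ₗ[k] (⨁ i, B i) →ₗ[k] k}
    (h : IsQuadraticPerm circ ω) : (⨁ i, B i) →ₗ[k] CTwo k B :=
  (existsUnique_coproduct h).choose

theorem nuOmega_spec {circ : Op k (⨁ i, B i)} {ω : (⨁ i, B i) →ₗ[k] (⨁ i, B i) →ₗ[k] k}
    (h : IsQuadraticPerm circ ω) (b s t : ⨁ i, B i) :
    omegaHat ω (nuOmega h b) s t = -ω b (circ s t) :=
  (existsUnique_coproduct h).choose_spec.1 b s t

end Quadratic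

/-! ### The structure induced on `P ⊗ B` -/

section Induced

variable {k : Type u} [Field k]
variable {P : Type w} [AddCommGroup P] [Module k P]
variable {B : ℤ → Type v} [∀ i, AddCommGroup (B i)] [∀ i, Module k (B i)]

/-- The homogeneous pieces `P ⊗ B_i` of `P ⊗ B`. -/
abbrev PB (k : Type u) [Field k] (P : Type w) [AddCommGroup P] [Module k P]
    (B : ℤ → Type v) [∀ i, AddCommGroup (B i)] [∀ i, Module k (B i)] (i : ℤ) : Type (max v w) :=
  P ⊗[k] B i

/-- The identification `P ⊗ (⨁ B_i) = ⨁ (P ⊗ B_i)`. -/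
def distrib (k : Type u) [Field k] (P : Type w) [AddCommGroup P] [Module k P]
    (B : ℤ → Type v) [∀ i, AddCommGroup (B i)] [∀ i, Module k (B i)] :
    P ⊗[k] (⨁ i, B i) ≃ₗ[k] ⨁ i, PB k P B i :=
  TensorProduct.directSumRight k k P B

/-- The operation `(p ⊗ b, q ⊗ c) ↦ m(p, q) ⊗ (b ∘ c)` on `P ⊗ B`. -/
def indOp (m : Op k P) (circ : Op k (⨁ i, B i)) : Op k (⨁ i, PB k P B i) :=
  ((TensorProduct.map₂ m circ).compl₁₂ (distrib k P B).symm.toLinearMap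
    (distrib k P B).symm.toLinearMap).compr₂ (distrib k P B).toLinearMap

/-- `X • Y ∈ (P ⊗ B) ⊗̂ (P ⊗ B)` for `X ∈ P ⊗ P` and `Y ∈ B ⊗̂ B`:
`(∑ p ⊗ q) • (∑ b ⊗ c) = ∑ (p ⊗ b) ⊗ (q ⊗ c)`. -/
def bullet : (P ⊗[k] P) →ₗ[k] CTwo k B →ₗ[k] CTwo k (PB k P B) :=
  LinearMap.mk₂ k
    (fun X Y i j => TensorProduct.tensorTensorTensorComm k P P (B i) (B j) (X ⊗ₜ[k] Y i j))
    (fun _ _ _ => by ext i j; simp [TensorProduct.add_tmul])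
    (fun c X Y => by
      funext i j
      exact (TensorProduct.tensorTensorTensorComm k P P (B i) (B j)).map_smul c (X ⊗ₜ[k] Y i j))
    (fun _ _ _ => by ext i j; simp [TensorProduct.tmul_add])
    (fun _ _ _ => by ext i j; simp)

/-- The completed comultiplication `p ⊗ b ↦ D(p) • N(b)` on `P ⊗ B`. -/
def indCo (D : P →ₗ[k] P ⊗[k] P) (N : (⨁ i, B i) →ₗ[k] CTwo k B) :
    (⨁ i, PB k P B i) →ₗ[k] CTwo k (PB k P B) :=
  TensorProduct.lift ((bullet (k := k) (P := P) (B := B)).compl₁₂ D N) ∘ₗ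
    (distrib k P B).symm.toLinearMap

theorem indOp_tmul (m : Op k P) (circ : Op k (⨁ i, B i)) (p q : P) (b c : ⨁ i, B i) :
    indOp m circ (distrib k P B (p ⊗ₜ b)) (distrib k P B (q ⊗ₜ c)) =
      distrib k P B (m p q ⊗ₜ circ b c) := by
  simp [indOp]

theorem indCo_tmul (D : P →ₗ[k] P ⊗[k] P) (N : (⨁ i, B i) →ₗ[k] CTwo k B) (p : P)
    (b : ⨁ i, B i) : indCo D N (distrib k P B (p ⊗ₜ b)) = bullet (D p) (N b) := by
  simp [indCo]

/-- `e` is a basis of `B` consisting of homogeneous elements and `f` is its dual basis with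
respect to `ω`: `ω(f_i, e_j) = δ_{ij}`. -/
structure IsDualHomogeneousPair {Ω : Type*} (ω : (⨁ i, B i) →ₗ[k] (⨁ i, B i) →ₗ[k] k)
    (e : Module.Basis Ω k (⨁ i, B i)) (f : Ω → ⨁ i, B i) : Prop where
  homogeneous : ∀ w, ∃ (i : ℤ) (x : B i), e w = inc k B i x
  dual_self : ∀ w, ω (f w) (e w) = 1
  dual_ne : ∀ w w', w ≠ w' → ω (f w) (e w') = 0

/-- `∑_j e_j ⊗ f_j ∈ B ⊗̂ B`; in each bidegree the sum is finite when `e` is a homogeneous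
basis. -/
def casimir {Ω : Type*} (e f : Ω → ⨁ i, B i) : CTwo k B :=
  fun a b => ∑ᶠ w, proj k B a (e w) ⊗ₜ[k] proj k B b (f w)

/-- `r̂ = ∑_i ∑_j (x_i ⊗ e_j) ⊗ (y_i ⊗ f_j)` for `r = ∑_i x_i ⊗ y_i`. -/
def rHat {Ω : Type*} (e f : Ω → ⨁ i, B i) (r : P ⊗[k] P) : CTwo k (PB k P B) :=
  bullet r (casimir e f)

end Induced

end DPP
end

/-!
The proof transports every identity on `A = P ⊗ B` to identities on tensor powers of `P` with scalar
coefficients, by contracting the `B`-components with the form `ω`.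

For `s ∈ B` let `pairAt ω s : A → P` be the map `p ⊗ b ↦ ω(b, s) p`. Since `ω` is graded, it vanishes
on all but finitely many pieces `A_i`, so its tensor products extend to the completed tensor square
and cube of `A` (`pairTwo`, `pairThree`). Since `ω` is nondegenerate and the pieces of `B` are
finite-dimensional, each projection `A → A_i` is a finite combination of such contractions. Hence
contractions separate points (`pairTwo_ext`, `pairThree_ext`), and the finiteness conditions on formal
sums follow from the finite support of the contractions (`finCo_indCo`, `finLeft_rHat`).

Under contraction, multiplication operators turn into their adjoints. Left multiplications of `B` are
self-adjoint and the adjoint of `R(b)` is `L(b) - R(b)` (`omega_mul_left`). The induced coproduct of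
`p ⊗ b` contracts with `s` and `t` to `-ω(b, s ∘ t) D(p)` (`pairTwo_indCo`). Consequently:

* in the coalgebra identities every term carries the same scalar `ω(b, s ∘ (t ∘ r))`, so they reduce
  to the identities of the Poisson coalgebra;
* in the compatibility conditions all scalars are values of the quadrilinear form `ω(c, b ∘ (s ∘ t))`,
  among which one linear relation is needed (`quadForm_rel`); after using it, each condition is a
  scalar multiple of one of the compatibility conditions of the Poisson bialgebra or of its twist.

For the coboundary part, `∑ e_j ⊗ f_j` represents the form `(s, t) ↦ ω(t, s)` (`omegaHat_casimir`),
so `r̂` contracts to `ω(t, s) r` (`pairTwo_rHat`), and the formulas for `ν`, `ϑ` and the invariance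
follow as before; in particular `r̂ - τ̂(r̂)` is the tensor attached to `r + τ(r)`. For the
Yang-Baxter equations, contracting only the second factor of `r̂` with `t` inserts `t` into the first
factor of `r` (`isSlice_rHat`), and a threefold product contracts to the product of two such slices
(`contrThree_familyProd`). The scalars `ω(t ∘ u, s)`, `ω(s ∘ u, t)` and `ω(s ∘ t, u)` that appear are
related by invariance, which leaves the Poisson Yang-Baxter equations.
-/

open scoped TensorProduct DirectSum

noncomputable section

namespace DPP

universe u v w

/-! ### Contractions of completed tensor products -/

section Contraction

variable {k : Type u} [Field k]
variable {A : ℤ → Type v} [∀ i, AddCommGroup (A i)] [∀ i, Module k (A i)]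
variable {V W U : Type*} [AddCommGroup V] [Module k V] [AddCommGroup W] [Module k W]
  [AddCommGroup U] [Module k U]

/-- `φ` vanishes on all but finitely many homogeneous pieces. Such maps are the ones that extend
to formal sums of homogeneous elements. -/
def FinSupp (φ : (⨁ i, A i) →ₗ[k] V) : Prop :=
  ∃ S : Finset ℤ, ∀ i ∉ S, φ ∘ₗ inc k A i = 0

theorem FinSupp.comp {φ : (⨁ i, A i) →ₗ[k] V} (h : FinSupp φ) (g : V →ₗ[k] W) :
    FinSupp (g ∘ₗ φ) := by
  obtain ⟨S, hS⟩ := h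
  exact ⟨S, fun i hi => by rw [LinearMap.comp_assoc, hS i hi, LinearMap.comp_zero]⟩

theorem FinSupp.add {φ ψ : (⨁ i, A i) →ₗ[k] V} (h : FinSupp φ) (h' : FinSupp ψ) :
    FinSupp (φ + ψ) := by
  classical
  obtain ⟨S, hS⟩ := h
  obtain ⟨T, hT⟩ := h'
  refine ⟨S ∪ T, fun i hi => ?_⟩
  rw [Finset.mem_union, not_or] at hi
  rw [LinearMap.add_comp, hS i hi.1, hT i hi.2, add_zero]

theorem finSupp_zero : FinSupp (0 : (⨁ i, A i) →ₗ[k] V) :=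
  ⟨∅, fun _ _ => LinearMap.zero_comp _⟩

theorem finSupp_sum {ι : Type*} (s : Finset ι) {φ : ι → (⨁ i, A i) →ₗ[k] V}
    (h : ∀ l ∈ s, FinSupp (φ l)) : FinSupp (∑ l ∈ s, φ l) := by
  classical
  induction s using Finset.induction_on with
  | empty => simpa using finSupp_zero
  | insert a s ha ih =>
    rw [Finset.sum_insert ha]
    exact (h a (Finset.mem_insert_self a s)).add
      (ih fun l hl => h l (Finset.mem_insert_of_mem hl))

theorem proj_inc_self (i : ℤ) (x : A i) : proj k A i (inc k A i x) = x :=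
  DirectSum.component.lof_self k i x

theorem proj_inc_ne {i j : ℤ} (h : j ≠ i) (x : A j) : proj k A i (inc k A j x) = 0 := by
  rw [DirectSum.component.of, dif_neg h]

theorem proj_comp_inc_self (i : ℤ) : proj k A i ∘ₗ inc k A i = LinearMap.id :=
  LinearMap.ext fun x => proj_inc_self (k := k) i x

theorem proj_comp_inc_ne {i j : ℤ} (h : j ≠ i) : proj k A i ∘ₗ inc k A j = 0 :=
  LinearMap.ext fun x => proj_inc_ne (k := k) h x

theorem finSupp_proj (i : ℤ) : FinSupp (proj k A i) :=
  ⟨{i}, fun _ hj => proj_comp_inc_ne (by simpa using hj)⟩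

/-- A map of finite support is the sum of its restrictions to the homogeneous pieces. -/
theorem eq_sum_of_finSupp {φ : (⨁ i, A i) →ₗ[k] V} {S : Finset ℤ}
    (hS : ∀ i ∉ S, φ ∘ₗ inc k A i = 0) : φ = ∑ i ∈ S, φ ∘ₗ inc k A i ∘ₗ proj k A i := by
  refine DirectSum.linearMap_ext k fun j => LinearMap.ext fun x => ?_
  simp only [LinearMap.comp_apply, LinearMap.sum_apply]
  by_cases hj : j ∈ S
  · rw [Finset.sum_eq_single_of_mem j hj, proj_inc_self]
    intro i _ hij
    rw [proj_inc_ne hij.symm, map_zero, map_zero]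
  · rw [Finset.sum_eq_zero]
    · exact LinearMap.congr_fun (hS j hj) x
    · intro i hi
      rw [proj_inc_ne (fun h : j = i => hj (h.symm ▸ hi)), map_zero, map_zero]

/-- The extension of `φ ⊗ ψ` to the completed tensor square, for `φ` and `ψ` of finite support. -/
def contrTwo (φ : (⨁ i, A i) →ₗ[k] V) (ψ : (⨁ i, A i) →ₗ[k] W) : CTwo k A →ₗ[k] V ⊗[k] W :=
  ∑ᶠ ij : ℤ × ℤ, TensorProduct.map (φ ∘ₗ inc k A ij.1) (ψ ∘ₗ inc k A ij.2) ∘ₗ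
    LinearMap.proj ij.2 ∘ₗ LinearMap.proj ij.1

/-- The extension of `φ ⊗ ψ ⊗ χ` to the completed tensor cube, for `φ`, `ψ` and `χ` of finite
support. -/
def contrThree (φ : (⨁ i, A i) →ₗ[k] V) (ψ : (⨁ i, A i) →ₗ[k] W) (χ : (⨁ i, A i) →ₗ[k] U) :
    CThree k A →ₗ[k] V ⊗[k] (W ⊗[k] U) :=
  ∑ᶠ t : ℤ × ℤ × ℤ, TensorProduct.map (φ ∘ₗ inc k A t.1)
      (TensorProduct.map (ψ ∘ₗ inc k A t.2.1) (χ ∘ₗ inc k A t.2.2)) ∘ₗ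
    LinearMap.proj t.2.2 ∘ₗ LinearMap.proj t.2.1 ∘ₗ LinearMap.proj t.1

section Values

variable {φ : (⨁ i, A i) →ₗ[k] V} {ψ : (⨁ i, A i) →ₗ[k] W} {χ : (⨁ i, A i) →ₗ[k] U}
variable {S T R : Finset ℤ}

theorem contrTwo_apply (hS : ∀ i ∉ S, φ ∘ₗ inc k A i = 0) (hT : ∀ i ∉ T, ψ ∘ₗ inc k A i = 0)
    (X : CTwo k A) : contrTwo φ ψ X =
      ∑ i ∈ S, ∑ j ∈ T, TensorProduct.map (φ ∘ₗ inc k A i) (ψ ∘ₗ inc k A j) (X i j) := by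
  classical
  rw [contrTwo, finsum_eq_sum_of_support_subset (s := S ×ˢ T), LinearMap.sum_apply,
    Finset.sum_product]
  · rfl
  · intro ij hij
    rw [Finset.coe_product]
    by_contra hne
    refine hij ?_
    beta_reduce
    rw [Set.mem_prod, not_and_or] at hne
    rcases hne with h | h
    · rw [hS _ h, TensorProduct.map_zero_left, LinearMap.zero_comp]
    · rw [hT _ h, TensorProduct.map_zero_right, LinearMap.zero_comp]

theorem contrThree_apply (hS : ∀ i ∉ S, φ ∘ₗ inc k A i = 0) (hT : ∀ i ∉ T, ψ ∘ₗ inc k A i = 0)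
    (hR : ∀ i ∉ R, χ ∘ₗ inc k A i = 0) (X : CThree k A) : contrThree φ ψ χ X =
      ∑ a ∈ S, ∑ b ∈ T, ∑ c ∈ R, TensorProduct.map (φ ∘ₗ inc k A a)
        (TensorProduct.map (ψ ∘ₗ inc k A b) (χ ∘ₗ inc k A c)) (X a b c) := by
  classical
  rw [contrThree, finsum_eq_sum_of_support_subset (s := S ×ˢ T ×ˢ R), LinearMap.sum_apply,
    Finset.sum_product]
  · refine Finset.sum_congr rfl fun a _ => ?_
    rw [Finset.sum_product]
    rfl
  · intro t ht
    rw [Finset.coe_product, Finset.coe_product]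
    by_contra hne
    refine ht ?_
    beta_reduce
    rw [Set.mem_prod, Set.mem_prod, not_and_or, not_and_or] at hne
    rcases hne with h | h | h
    · rw [hS _ h, TensorProduct.map_zero_left, LinearMap.zero_comp]
    · rw [hT _ h, TensorProduct.map_zero_left, TensorProduct.map_zero_right, LinearMap.zero_comp]
    · rw [hR _ h, TensorProduct.map_zero_right, TensorProduct.map_zero_right, LinearMap.zero_comp]

theorem contrTwo_proj (i j : ℤ) (X : CTwo k A) :
    contrTwo (proj k A i) (proj k A j) X = X i j := by
  have h : ∀ i j : ℤ, j ∉ ({i} : Finset ℤ) → proj k A i ∘ₗ inc k A j = 0 := fun i j hj =>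
    proj_comp_inc_ne (by simpa using hj)
  rw [contrTwo_apply (h i) (h j), Finset.sum_singleton, Finset.sum_singleton,
    proj_comp_inc_self, proj_comp_inc_self,
    TensorProduct.map_id, LinearMap.id_apply]

end Values

section Functoriality

variable {φ : (⨁ i, A i) →ₗ[k] V} {ψ : (⨁ i, A i) →ₗ[k] W} {χ : (⨁ i, A i) →ₗ[k] U}
variable {V' W' U' : Type*} [AddCommGroup V'] [Module k V'] [AddCommGroup W'] [Module k W']
  [AddCommGroup U'] [Module k U']

theorem contrTwo_comp (hφ : FinSupp φ) (hψ : FinSupp ψ) (f : V →ₗ[k] V') (g : W →ₗ[k] W')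
    (X : CTwo k A) :
    contrTwo (f ∘ₗ φ) (g ∘ₗ ψ) X = TensorProduct.map f g (contrTwo φ ψ X) := by
  obtain ⟨S, hS⟩ := hφ
  obtain ⟨T, hT⟩ := hψ
  rw [contrTwo_apply hS hT, contrTwo_apply (S := S) (T := T)]
  · simp only [map_sum, LinearMap.comp_assoc, TensorProduct.map_comp, LinearMap.comp_apply]
  · intro i hi
    rw [LinearMap.comp_assoc, hS i hi, LinearMap.comp_zero]
  · intro i hi
    rw [LinearMap.comp_assoc, hT i hi, LinearMap.comp_zero]

theorem sum_comp_linearMap {M : Type*} [AddCommGroup M] [Module k M] {ι : Type*} (s : Finset ι)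
    (f : ι → V →ₗ[k] W) (g : M →ₗ[k] V) : (∑ l ∈ s, f l) ∘ₗ g = ∑ l ∈ s, f l ∘ₗ g := by
  ext x
  simp

theorem map_sum_left {M N : Type*} [AddCommGroup M] [Module k M] [AddCommGroup N] [Module k N]
    {ι : Type*} (s : Finset ι) (f : ι → M →ₗ[k] V) (g : N →ₗ[k] W) (x : M ⊗[k] N) :
    TensorProduct.map (∑ l ∈ s, f l) g x = ∑ l ∈ s, TensorProduct.map (f l) g x := by
  have := LinearMap.map_sum₂ (TensorProduct.mapBilinear (RingHom.id k) M N V W) s f g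
  exact (LinearMap.congr_fun this x).trans (LinearMap.sum_apply _ _ _)

theorem map_sum_right {M N : Type*} [AddCommGroup M] [Module k M] [AddCommGroup N] [Module k N]
    {ι : Type*} (s : Finset ι) (f : M →ₗ[k] V) (g : ι → N →ₗ[k] W) (x : M ⊗[k] N) :
    TensorProduct.map f (∑ l ∈ s, g l) x = ∑ l ∈ s, TensorProduct.map f (g l) x := by
  have := map_sum (TensorProduct.mapBilinear (RingHom.id k) M N V W f) g s
  exact (LinearMap.congr_fun this x).trans (LinearMap.sum_apply _ _ _)

theorem contrTwo_sum_left {ι : Type*} (s : Finset ι) {φ : ι → (⨁ i, A i) →ₗ[k] V}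
    (hφ : ∀ l ∈ s, FinSupp (φ l)) (hψ : FinSupp ψ) (X : CTwo k A) :
    contrTwo (∑ l ∈ s, φ l) ψ X = ∑ l ∈ s, contrTwo (φ l) ψ X := by
  classical
  choose! S hS using hφ
  obtain ⟨T, hT⟩ := hψ
  have hS' : ∀ l ∈ s, ∀ i ∉ s.biUnion S, φ l ∘ₗ inc k A i = 0 := fun l hl i hi =>
    hS l hl i fun h => hi (Finset.mem_biUnion.2 ⟨l, hl, h⟩)
  have h := Finset.sum_congr (rfl : s = s) fun l hl => contrTwo_apply (hS' l hl) hT X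
  rw [contrTwo_apply (S := s.biUnion S) _ hT, h]
  · symm
    rw [Finset.sum_comm]
    refine Finset.sum_congr rfl fun i _ => ?_
    rw [Finset.sum_comm]
    refine Finset.sum_congr rfl fun j _ => ?_
    rw [sum_comp_linearMap, map_sum_left]
  · intro i hi
    rw [sum_comp_linearMap]
    exact Finset.sum_eq_zero fun l hl => hS' l hl i hi

/-! ### Twists -/

theorem contrTwo_hatTau (hφ : FinSupp φ) (hψ : FinSupp ψ) (X : CTwo k A) :
    contrTwo φ ψ (hatTau X) = TensorProduct.comm k W V (contrTwo ψ φ X) := by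
  obtain ⟨S, hS⟩ := hφ
  obtain ⟨T, hT⟩ := hψ
  rw [contrTwo_apply hS hT, contrTwo_apply hT hS, Finset.sum_comm]
  simp only [map_sum]
  refine Finset.sum_congr rfl fun i _ => Finset.sum_congr rfl fun j _ => ?_
  exact (TensorProduct.map_comm _ _ _)

theorem contrThree_hatTau12 (hφ : FinSupp φ) (hψ : FinSupp ψ) (hχ : FinSupp χ)
    (X : CThree k A) :
    contrThree φ ψ χ (hatTau12 X) =
      TensorProduct.leftComm k W V U (contrThree ψ φ χ X) := by
  obtain ⟨S, hS⟩ := hφ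
  obtain ⟨T, hT⟩ := hψ
  obtain ⟨R, hR⟩ := hχ
  rw [contrThree_apply hS hT hR, contrThree_apply hT hS hR, Finset.sum_comm]
  simp only [map_sum]
  refine Finset.sum_congr rfl fun b _ => Finset.sum_congr rfl fun a _ =>
    Finset.sum_congr rfl fun c _ => ?_
  rw [hatTau12]
  induction X b a c using TensorProduct.induction_on with
  | zero => simp
  | add x y hx hy => simp only [map_add, hx, hy]
  | tmul x y =>
    induction y using TensorProduct.induction_on with
    | zero => simp
    | add y z hy hz => simp only [TensorProduct.tmul_add, map_add, hy, hz]
    | tmul y z => simp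

end Functoriality

end Contraction


/-! ### Multiplication operators and comultiplications under contraction -/

section Operators

variable {k : Type u} [Field k]
variable {A : ℤ → Type v} [∀ i, AddCommGroup (A i)] [∀ i, Module k (A i)]
variable {V W U : Type*} [AddCommGroup V] [Module k V] [AddCommGroup W] [Module k W]
  [AddCommGroup U] [Module k U]
variable {φ φ' : (⨁ i, A i) →ₗ[k] V} {ψ : (⨁ i, A i) →ₗ[k] W} {χ : (⨁ i, A i) →ₗ[k] U}

theorem contrTwo_add_left (hφ : FinSupp φ) (hφ' : FinSupp φ') (hψ : FinSupp ψ) (X : CTwo k A) :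
    contrTwo (φ + φ') ψ X = contrTwo φ ψ X + contrTwo φ' ψ X := by
  have h := contrTwo_sum_left Finset.univ (φ := fun b : Bool => if b then φ else φ')
    (fun b _ => by cases b <;> simpa) hψ X
  simpa using h

theorem contrTwo_neg_left (hφ : FinSupp φ) (hψ : FinSupp ψ) (X : CTwo k A) :
    contrTwo (-φ) ψ X = -contrTwo φ ψ X := by
  have h := contrTwo_comp hφ hψ (-LinearMap.id) LinearMap.id X
  rw [LinearMap.id_comp, LinearMap.neg_comp, LinearMap.id_comp] at h
  rw [h, ← neg_one_smul k LinearMap.id, TensorProduct.map_smul_left, TensorProduct.map_id]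
  simp

/-- `f` has finitely many nonzero components into each homogeneous piece, so that `f ⊗̂ id` is
defined on formal sums. -/
class FinDeg (f : (⨁ i, A i) →ₗ[k] ⨁ i, A i) : Prop where
  finSupp : ∀ a, FinSupp (proj k A a ∘ₗ f)

theorem FinSupp.comp_finDeg (hφ : FinSupp φ) (f : (⨁ i, A i) →ₗ[k] ⨁ i, A i) [hf : FinDeg f] :
    FinSupp (φ ∘ₗ f) := by
  obtain ⟨S, hS⟩ := hφ
  have h : φ ∘ₗ f = ∑ i ∈ S, (φ ∘ₗ inc k A i) ∘ₗ (proj k A i ∘ₗ f) := by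
    conv_lhs => rw [eq_sum_of_finSupp hS, sum_comp_linearMap]
    rfl
  rw [h]
  exact finSupp_sum S fun i _ => (hf.finSupp i).comp _

instance FinDeg.add (f g : (⨁ i, A i) →ₗ[k] ⨁ i, A i) [hf : FinDeg f] [hg : FinDeg g] :
    FinDeg (f + g) where
  finSupp a := by
    rw [LinearMap.comp_add]
    exact (hf.finSupp a).add (hg.finSupp a)

instance FinDeg.neg (f : (⨁ i, A i) →ₗ[k] ⨁ i, A i) [hf : FinDeg f] : FinDeg (-f) where
  finSupp a := by
    rw [LinearMap.comp_neg]
    simpa [LinearMap.neg_comp] using (hf.finSupp a).comp (-LinearMap.id)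

instance FinDeg.sub (f g : (⨁ i, A i) →ₗ[k] ⨁ i, A i) [hf : FinDeg f] [hg : FinDeg g] :
    FinDeg (f - g) := by
  rw [sub_eq_add_neg]
  infer_instance

/-- All left and right multiplications have finitely many components into each piece. -/
class LocFin (m : Op k (⨁ i, A i)) : Prop where
  left : ∀ a, FinDeg (m a)
  right : ∀ a, FinDeg (m.flip a)

attribute [instance] LocFin.left LocFin.right

theorem IsGradedOp.flip {m : Op k (⨁ i, A i)} (hm : IsGradedOp m) : IsGradedOp m.flip := by
  intro i j x y
  obtain ⟨z, hz⟩ := hm j i y x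
  rw [add_comm i j]
  exact ⟨z, hz⟩

theorem IsGradedOp.finDeg {m : Op k (⨁ i, A i)} (hm : IsGradedOp m) (a : ⨁ i, A i) :
    FinDeg (m a) := by
  induction a using DirectSum.induction_on with
  | zero => exact ⟨fun a => by simpa using finSupp_zero⟩
  | add a b ha hb =>
    rw [map_add]
    infer_instance
  | of i x =>
    refine ⟨fun a => ⟨{a - i}, fun j hj => LinearMap.ext fun y => ?_⟩⟩
    obtain ⟨z, hz⟩ := hm i j x y
    rw [Finset.mem_singleton] at hj
    change proj k A a (m (inc k A i x) (inc k A j y)) = 0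
    rw [hz, proj_inc_ne (by omega)]

theorem IsGradedOp.locFin {m : Op k (⨁ i, A i)} (hm : IsGradedOp m) : LocFin m :=
  ⟨hm.finDeg, hm.flip.finDeg⟩

/-- The formal sums defining `f ⊗̂ id` can be moved to the other side of a contraction. -/
theorem contrTwo_hatL (hφ : FinSupp φ) (hψ : FinSupp ψ) (f : (⨁ i, A i) →ₗ[k] ⨁ i, A i)
    [hf : FinDeg f] (X : CTwo k A) :
    contrTwo φ ψ (hatL f X) = contrTwo (φ ∘ₗ f) ψ X := by
  classical
  obtain ⟨S, hS⟩ := hφ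
  obtain ⟨T, hT⟩ := hψ
  choose R hR using hf.finSupp
  have hR' : ∀ a ∈ S, ∀ i ∉ S.biUnion R, proj k A a ∘ₗ f ∘ₗ inc k A i = 0 := fun a ha i hi =>
    hR a i fun h => hi (Finset.mem_biUnion.2 ⟨a, ha, h⟩)
  have hφf : ∀ i, (φ ∘ₗ f) ∘ₗ inc k A i =
      ∑ a ∈ S, (φ ∘ₗ inc k A a) ∘ₗ (proj k A a ∘ₗ f ∘ₗ inc k A i) := by
    intro i
    conv_lhs => rw [eq_sum_of_finSupp hS, sum_comp_linearMap, sum_comp_linearMap]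
    rfl
  rw [contrTwo_apply hS hT, contrTwo_apply (S := S.biUnion R) (T := T) _ hT]
  · have h : ∀ a ∈ S, ∀ b, hatL f X a b = ∑ i ∈ S.biUnion R,
        LinearMap.rTensor (A b) (proj k A a ∘ₗ f ∘ₗ inc k A i) (X i b) := by
      intro a ha b
      refine finsum_eq_sum_of_support_subset _ fun i hi => ?_
      by_contra hne
      exact hi (by beta_reduce; rw [hR' a ha i hne, LinearMap.rTensor_zero, LinearMap.zero_apply])
    simp only [hφf, map_sum_left]
    rw [Finset.sum_congr rfl fun a ha => Finset.sum_congr rfl fun b _ => by rw [h a ha b, map_sum],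
      Finset.sum_comm]
    symm
    rw [Finset.sum_comm]
    refine Finset.sum_congr rfl fun b _ => ?_
    rw [Finset.sum_comm]
    refine Finset.sum_congr rfl fun a _ => Finset.sum_congr rfl fun i _ => ?_
    rw [← LinearMap.comp_apply, LinearMap.map_comp_rTensor]
  · intro i hi
    rw [hφf]
    exact Finset.sum_eq_zero fun a ha => by rw [hR' a ha i hi, LinearMap.comp_zero]

theorem hatR_eq (f : (⨁ i, A i) →ₗ[k] ⨁ i, A i) (X : CTwo k A) :
    hatR f X = hatTau (hatL f (hatTau X)) := by
  funext a b
  refine Eq.trans ?_ (AddEquiv.map_finsum (TensorProduct.comm k (A b) (A a)).toAddEquiv _).symm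
  refine finsum_congr fun j => ?_
  change _ = TensorProduct.comm k (A b) (A a)
    (LinearMap.rTensor (A a) _ (TensorProduct.comm k (A a) (A j) (X a j)))
  induction X a j using TensorProduct.induction_on with
  | zero => simp
  | tmul x y => simp
  | add x y hx hy => simp only [map_add, hx, hy]

theorem hatTau_hatTau (X : CTwo k A) : hatTau (hatTau X) = X := by
  funext i j
  exact (TensorProduct.comm k (A i) (A j)).symm_apply_apply (X i j)

theorem contrTwo_sum_right {ι : Type*} (s : Finset ι) {ψ : ι → (⨁ i, A i) →ₗ[k] W}
    (hφ : FinSupp φ) (hψ : ∀ l ∈ s, FinSupp (ψ l)) (X : CTwo k A) :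
    contrTwo φ (∑ l ∈ s, ψ l) X = ∑ l ∈ s, contrTwo φ (ψ l) X := by
  rw [← hatTau_hatTau X, contrTwo_hatTau hφ (finSupp_sum s hψ), contrTwo_sum_left s hψ hφ, map_sum]
  exact Finset.sum_congr rfl fun l hl => (contrTwo_hatTau hφ (hψ l hl) _).symm

theorem hatL_hatTau (f : (⨁ i, A i) →ₗ[k] ⨁ i, A i) (X : CTwo k A) :
    hatL f (hatTau X) = hatTau (hatR f X) := by
  rw [hatR_eq, hatTau_hatTau]

theorem hatR_hatTau (f : (⨁ i, A i) →ₗ[k] ⨁ i, A i) (X : CTwo k A) :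
    hatR f (hatTau X) = hatTau (hatL f X) := by
  rw [hatR_eq, hatTau_hatTau]

theorem contrTwo_hatR (hφ : FinSupp φ) (hψ : FinSupp ψ) (f : (⨁ i, A i) →ₗ[k] ⨁ i, A i)
    [FinDeg f] (X : CTwo k A) :
    contrTwo φ ψ (hatR f X) = contrTwo φ (ψ ∘ₗ f) X := by
  rw [hatR_eq, contrTwo_hatTau hφ hψ, contrTwo_hatL hψ hφ,
    contrTwo_hatTau (hψ.comp_finDeg f) hφ, ← LinearEquiv.trans_apply]
  simp

theorem hatL_eq_contrTwo (f : (⨁ i, A i) →ₗ[k] ⨁ i, A i) [FinDeg f] (X : CTwo k A) (a b : ℤ) :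
    hatL f X a b = contrTwo (proj k A a ∘ₗ f) (proj k A b) X := by
  rw [← contrTwo_hatL (finSupp_proj a) (finSupp_proj b), contrTwo_proj]

theorem hatL_add_right (f : (⨁ i, A i) →ₗ[k] ⨁ i, A i) [FinDeg f] (X Y : CTwo k A) :
    hatL f (X + Y) = hatL f X + hatL f Y := by
  funext a b
  simp only [hatL_eq_contrTwo, map_add, Pi.add_apply]

theorem hatL_add_left (f g : (⨁ i, A i) →ₗ[k] ⨁ i, A i) [hf : FinDeg f] [hg : FinDeg g]
    (X : CTwo k A) : hatL (f + g) X = hatL f X + hatL g X := by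
  funext a b
  simp only [hatL_eq_contrTwo, LinearMap.comp_add, Pi.add_apply]
  exact contrTwo_add_left (hf.finSupp a) (hg.finSupp a) (finSupp_proj b) X

theorem hatL_neg_left (f : (⨁ i, A i) →ₗ[k] ⨁ i, A i) [hf : FinDeg f] (X : CTwo k A) :
    hatL (-f) X = -hatL f X := by
  funext a b
  simp only [hatL_eq_contrTwo, LinearMap.comp_neg, Pi.neg_apply]
  exact contrTwo_neg_left (hf.finSupp a) (finSupp_proj b) X

theorem hatL_sub_left (f g : (⨁ i, A i) →ₗ[k] ⨁ i, A i) [FinDeg f] [FinDeg g] (X : CTwo k A) :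
    hatL (f - g) X = hatL f X - hatL g X := by
  rw [sub_eq_add_neg, hatL_add_left, hatL_neg_left, sub_eq_add_neg]

theorem hatL_sub_right (f : (⨁ i, A i) →ₗ[k] ⨁ i, A i) [FinDeg f] (X Y : CTwo k A) :
    hatL f (X - Y) = hatL f X - hatL f Y := by
  funext a b
  simp only [hatL_eq_contrTwo, map_sub, Pi.sub_apply]

theorem hatL_zero_left (X : CTwo k A) : hatL 0 X = 0 := by
  funext a b
  simp [hatL]

theorem hatR_add_right (f : (⨁ i, A i) →ₗ[k] ⨁ i, A i) [FinDeg f] (X Y : CTwo k A) :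
    hatR f (X + Y) = hatR f X + hatR f Y := by
  simp only [hatR_eq, hatL_add_right, map_add]

theorem hatR_add_left (f g : (⨁ i, A i) →ₗ[k] ⨁ i, A i) [FinDeg f] [FinDeg g]
    (X : CTwo k A) : hatR (f + g) X = hatR f X + hatR g X := by
  simp only [hatR_eq, hatL_add_left, map_add]

theorem hatR_sub_left (f g : (⨁ i, A i) →ₗ[k] ⨁ i, A i) [FinDeg f] [FinDeg g]
    (X : CTwo k A) : hatR (f - g) X = hatR f X - hatR g X := by
  simp only [hatR_eq, hatL_sub_left, map_sub]

theorem hatR_sub_right (f : (⨁ i, A i) →ₗ[k] ⨁ i, A i) [FinDeg f] (X Y : CTwo k A) :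
    hatR f (X - Y) = hatR f X - hatR f Y := by
  simp only [hatR_eq, hatL_sub_right, map_sub]

theorem hatR_zero_left (X : CTwo k A) : hatR 0 X = 0 := by
  simp only [hatR_eq, hatL_zero_left, map_zero]

/-! ### Compositions of comultiplications -/

/-- Each component of `ν` in a given bidegree comes from finitely many homogeneous pieces. -/
def FinCo (ν : (⨁ i, A i) →ₗ[k] CTwo k A) : Prop :=
  ∀ a b, FinSupp (contrTwo (proj k A a) (proj k A b) ∘ₗ ν)

theorem blockCo_eq (ν : (⨁ i, A i) →ₗ[k] CTwo k A) (a b i : ℤ) :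
    blockCo ν a b i = (contrTwo (proj k A a) (proj k A b) ∘ₗ ν) ∘ₗ inc k A i :=
  LinearMap.ext fun x => (contrTwo_proj a b (ν (inc k A i x))).symm

theorem contrTwo_comp_inc {S T : Finset ℤ} (hS : ∀ i ∉ S, φ ∘ₗ inc k A i = 0)
    (hT : ∀ i ∉ T, ψ ∘ₗ inc k A i = 0) (ν : (⨁ i, A i) →ₗ[k] CTwo k A) (i : ℤ) :
    (contrTwo φ ψ ∘ₗ ν) ∘ₗ inc k A i = ∑ a ∈ S, ∑ b ∈ T,
      TensorProduct.map (φ ∘ₗ inc k A a) (ψ ∘ₗ inc k A b) ∘ₗ blockCo ν a b i := by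
  ext x
  simp only [LinearMap.comp_apply, LinearMap.sum_apply, contrTwo_apply hS hT]
  rfl

theorem FinCo.exists_finset {ν : (⨁ i, A i) →ₗ[k] CTwo k A} (hν : FinCo ν) (S T : Finset ℤ) :
    ∃ Q : Finset ℤ, ∀ a ∈ S, ∀ b ∈ T, ∀ i ∉ Q, blockCo ν a b i = 0 := by
  classical
  choose Q hQ using hν
  refine ⟨S.biUnion fun a => T.biUnion fun b => Q a b, fun a ha b hb i hi => ?_⟩
  rw [blockCo_eq]
  exact hQ a b i fun h =>
    hi (Finset.mem_biUnion.2 ⟨a, ha, Finset.mem_biUnion.2 ⟨b, hb, h⟩⟩)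

theorem FinCo.composable {ν μ : (⨁ i, A i) →ₗ[k] CTwo k A} (hν : FinCo ν) :
    Composable ν μ := by
  refine fun v => ⟨fun a b c => ?_, fun a b c => ?_⟩
  · obtain ⟨Q, hQ⟩ := hν a b
    refine Q.finite_toSet.subset fun i hi => ?_
    by_contra hne
    refine hi ?_
    rw [coLFamily, blockCo_eq, hQ i hne, LinearMap.rTensor_zero, LinearMap.zero_apply, map_zero]
  · obtain ⟨Q, hQ⟩ := hν b c
    refine Q.finite_toSet.subset fun i hi => ?_
    by_contra hne
    refine hi ?_
    rw [coRFamily, blockCo_eq, hQ i hne, LinearMap.lTensor_zero, LinearMap.zero_apply]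

/-- Contracting `(ν ⊗̂ id) μ(v)` amounts to contracting `μ(v)` with the pullback of `φ ⊗ ψ`
along `ν` in the first factor. -/
theorem contrThree_hatCoL {ν μ : (⨁ i, A i) →ₗ[k] CTwo k A} (hν : FinCo ν) (hφ : FinSupp φ)
    (hψ : FinSupp ψ) (hχ : FinSupp χ) (v : ⨁ i, A i) :
    contrThree φ ψ χ (hatCoL ν μ v) =
      TensorProduct.assoc k V W U (contrTwo (contrTwo φ ψ ∘ₗ ν) χ (μ v)) := by
  obtain ⟨S, hS⟩ := hφ
  obtain ⟨T, hT⟩ := hψ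
  obtain ⟨R, hR⟩ := hχ
  obtain ⟨Q, hQ⟩ := hν.exists_finset S T
  have hQ' : ∀ i ∉ Q, (contrTwo φ ψ ∘ₗ ν) ∘ₗ inc k A i = 0 := fun i hi => by
    rw [contrTwo_comp_inc hS hT]
    exact Finset.sum_eq_zero fun a ha => Finset.sum_eq_zero fun b hb => by
      rw [hQ a ha b hb i hi, LinearMap.comp_zero]
  have h : ∀ a ∈ S, ∀ b ∈ T, ∀ c, hatCoL ν μ v a b c = ∑ i ∈ Q, coLFamily ν μ v i a b c := by
    intro a ha b hb c
    refine finsum_eq_sum_of_support_subset _ fun i hi => ?_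
    by_contra hne
    refine hi ?_
    beta_reduce
    rw [coLFamily, hQ a ha b hb i hne, LinearMap.rTensor_zero, LinearMap.zero_apply, map_zero]
  rw [contrThree_apply hS hT hR, contrTwo_apply hQ' hR,
    Finset.sum_congr rfl fun a ha => Finset.sum_congr rfl fun b hb =>
      Finset.sum_congr rfl fun c _ => by rw [h a ha b hb c, map_sum]]
  simp only [contrTwo_comp_inc hS hT, map_sum_left, map_sum]
  symm
  rw [Finset.sum_congr rfl fun i _ => Finset.sum_comm, Finset.sum_comm]
  refine Finset.sum_congr rfl fun a _ => ?_
  rw [Finset.sum_congr rfl fun i _ => Finset.sum_comm, Finset.sum_comm]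
  refine Finset.sum_congr rfl fun b _ => ?_
  rw [Finset.sum_comm]
  refine Finset.sum_congr rfl fun c _ => Finset.sum_congr rfl fun i _ => ?_
  rw [coLFamily]
  induction μ v i c using TensorProduct.induction_on with
  | zero => simp
  | add x y hx hy => simp only [map_add, hx, hy]
  | tmul x y =>
    rw [LinearMap.rTensor_tmul, TensorProduct.map_tmul, LinearMap.comp_apply]
    induction blockCo ν a b i x using TensorProduct.induction_on with
    | zero => simp
    | add x y hx hy => simp only [map_add, TensorProduct.add_tmul, hx, hy]
    | tmul x y => simp

/-- Contracting `(id ⊗̂ ν) μ(v)` amounts to contracting `μ(v)` with the pullback of `ψ ⊗ χ`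
along `ν` in the second factor. -/
theorem contrThree_hatCoR {ν μ : (⨁ i, A i) →ₗ[k] CTwo k A} (hν : FinCo ν) (hφ : FinSupp φ)
    (hψ : FinSupp ψ) (hχ : FinSupp χ) (v : ⨁ i, A i) :
    contrThree φ ψ χ (hatCoR ν μ v) = contrTwo φ (contrTwo ψ χ ∘ₗ ν) (μ v) := by
  obtain ⟨S, hS⟩ := hφ
  obtain ⟨T, hT⟩ := hψ
  obtain ⟨R, hR⟩ := hχ
  obtain ⟨Q, hQ⟩ := hν.exists_finset T R
  have hQ' : ∀ i ∉ Q, (contrTwo ψ χ ∘ₗ ν) ∘ₗ inc k A i = 0 := fun i hi => by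
    rw [contrTwo_comp_inc hT hR]
    exact Finset.sum_eq_zero fun a ha => Finset.sum_eq_zero fun b hb => by
      rw [hQ a ha b hb i hi, LinearMap.comp_zero]
  have h : ∀ a, ∀ b ∈ T, ∀ c ∈ R, hatCoR ν μ v a b c = ∑ i ∈ Q, coRFamily ν μ v i a b c := by
    intro a b hb c hc
    refine finsum_eq_sum_of_support_subset _ fun i hi => ?_
    by_contra hne
    refine hi ?_
    beta_reduce
    rw [coRFamily, hQ b hb c hc i hne, LinearMap.lTensor_zero, LinearMap.zero_apply]
  rw [contrThree_apply hS hT hR, contrTwo_apply hS hQ',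
    Finset.sum_congr rfl fun a _ => Finset.sum_congr rfl fun b hb =>
      Finset.sum_congr rfl fun c hc => by rw [h a b hb c hc, map_sum]]
  simp only [contrTwo_comp_inc hT hR, map_sum_right]
  refine Finset.sum_congr rfl fun a _ => ?_
  symm
  rw [Finset.sum_comm]
  refine Finset.sum_congr rfl fun b _ => ?_
  rw [Finset.sum_comm]
  refine Finset.sum_congr rfl fun c _ => Finset.sum_congr rfl fun i _ => ?_
  rw [coRFamily, ← LinearMap.comp_apply, LinearMap.map_comp_lTensor]

end Operators


/-! ### Contracting `P ⊗ B` with the form of `B` -/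

section Pairing

variable {k : Type u} [Field k]
variable {P : Type w} [AddCommGroup P] [Module k P]
variable {B : ℤ → Type v} [∀ i, AddCommGroup (B i)] [∀ i, Module k (B i)]
variable {circB : Op k (⨁ i, B i)} {ω : (⨁ i, B i) →ₗ[k] (⨁ i, B i) →ₗ[k] k}

theorem inc_tmul (i : ℤ) (p : P) (x : B i) :
    inc k (PB k P B) i (p ⊗ₜ x) = distrib k P B (p ⊗ₜ inc k B i x) :=
  (TensorProduct.directSumRight_tmul_lof k k p i x).symm

theorem proj_distrib (i : ℤ) (p : P) (b : ⨁ i, B i) :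
    proj k (PB k P B) i (distrib k P B (p ⊗ₜ b)) = p ⊗ₜ proj k B i b := by
  induction b using DirectSum.induction_on with
  | zero => simp
  | add b c hb hc => simp only [TensorProduct.tmul_add, map_add, hb, hc]
  | of j x =>
    change proj k (PB k P B) i (distrib k P B (p ⊗ₜ inc k B j x)) = p ⊗ₜ proj k B i (inc k B j x)
    rw [← inc_tmul]
    by_cases h : j = i
    · subst h
      rw [proj_inc_self, proj_inc_self]
    · rw [proj_inc_ne h, proj_inc_ne h, TensorProduct.tmul_zero]

/-- Linear maps on `P ⊗ B` are determined by their values on the elements `p ⊗ b`. -/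
theorem linearMap_ext_tmul {M : Type*} [AddCommGroup M] [Module k M]
    {f g : (⨁ i, PB k P B i) →ₗ[k] M}
    (h : ∀ p b, f (distrib k P B (p ⊗ₜ b)) = g (distrib k P B (p ⊗ₜ b))) : f = g := by
  refine DirectSum.linearMap_ext k fun i => TensorProduct.ext' fun p x => ?_
  change f (inc k (PB k P B) i (p ⊗ₜ x)) = g (inc k (PB k P B) i (p ⊗ₜ x))
  rw [inc_tmul, h]

theorem induction_tmul {p : (⨁ i, PB k P B i) → Prop} (zero : p 0)
    (tmul : ∀ x b, p (distrib k P B (x ⊗ₜ b))) (add : ∀ a b, p a → p b → p (a + b))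
    (a : ⨁ i, PB k P B i) : p a := by
  obtain ⟨z, rfl⟩ := (distrib k P B).surjective a
  induction z using TensorProduct.induction_on with
  | zero => rwa [map_zero]
  | tmul x b => exact tmul x b
  | add y z hy hz =>
    rw [map_add]
    exact add _ _ hy hz

/-- The map `P ⊗ B → P`, `p ⊗ b ↦ ω(b, s) p`. -/
def pairAt (ω : (⨁ i, B i) →ₗ[k] (⨁ i, B i) →ₗ[k] k) (s : ⨁ i, B i) :
    (⨁ i, PB k P B i) →ₗ[k] P :=
  (TensorProduct.rid k P).toLinearMap ∘ₗ LinearMap.lTensor P (ω.flip s) ∘ₗ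
    (distrib k P B).symm.toLinearMap

theorem pairAt_tmul (s b : ⨁ i, B i) (p : P) :
    pairAt ω s (distrib k P B (p ⊗ₜ b)) = ω b s • p := by
  simp [pairAt]

theorem pairAt_add (s t : ⨁ i, B i) :
    (pairAt ω (s + t) : (⨁ i, PB k P B i) →ₗ[k] P) = pairAt ω s + pairAt ω t :=
  linearMap_ext_tmul fun p b => by
    rw [LinearMap.add_apply, pairAt_tmul, pairAt_tmul, pairAt_tmul, map_add, add_smul]

theorem finSupp_pairAt (hB : IsQuadraticPerm circB ω) (s : ⨁ i, B i) :
    FinSupp (pairAt ω s : (⨁ i, PB k P B i) →ₗ[k] P) := by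
  obtain ⟨m, hm⟩ := hB.graded
  induction s using DirectSum.induction_on with
  | zero =>
    convert finSupp_zero using 1
    exact linearMap_ext_tmul fun p b => by rw [pairAt_tmul, map_zero, zero_smul]; rfl
  | add s t hs ht =>
    rw [pairAt_add]
    exact hs.add ht
  | of j y =>
    refine ⟨{-m - j}, fun i hi => TensorProduct.ext' fun p x => ?_⟩
    rw [Finset.mem_singleton] at hi
    change pairAt ω (inc k B j y) (inc k (PB k P B) i (p ⊗ₜ x)) = 0
    rw [inc_tmul, pairAt_tmul, hm i j (by omega), zero_smul]

/-! ### The form separates points -/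

/-- Every linear form on a homogeneous piece is represented by the form of `B`. -/
theorem exists_omega_eq (hB : IsQuadraticPerm circB ω) (i : ℤ) (ξ : Module.Dual k (B i)) :
    ∃ s, ∀ b, ω b s = ξ (proj k B i b) := by
  obtain ⟨m, hm⟩ := hB.graded
  obtain ⟨y, hy⟩ := (omegaDual_bijective hB hm (i := -m - i) (j := i) (by omega)).2 (-ξ)
  refine ⟨inc k B (-m - i) y, fun b => ?_⟩
  have h : ω.flip (inc k B (-m - i) y) = ξ ∘ₗ proj k B i := by
    refine DirectSum.linearMap_ext k fun j => LinearMap.ext fun x => ?_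
    change ω (inc k B j x) (inc k B (-m - i) y) = ξ (proj k B i (inc k B j x))
    by_cases hj : j = i
    · subst hj
      rw [proj_inc_self, hB.skew]
      have := LinearMap.congr_fun hy x
      change ω (inc k B (-m - j) y) (inc k B j x) = -ξ x at this
      rw [this, neg_neg]
    · rw [proj_inc_ne hj, map_zero, hm _ _ (by omega)]
  exact LinearMap.congr_fun h b

/-- The projection to a homogeneous piece is a finite combination of contractions with `ω`. -/
theorem exists_proj_eq_sum (hB : IsQuadraticPerm circB ω) (i : ℤ) :
    ∃ (n : ℕ) (x : Fin n → B i) (s : Fin n → ⨁ i, B i),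
      (∀ l b, ω b (s l) = 0 ∨ proj k B i b ≠ 0) ∧
      ∀ b, proj k B i b = ∑ l, ω b (s l) • x l := by
  have := hB.alg.finite
  let x := Module.finBasis k (B i)
  choose s hs using fun l => exists_omega_eq hB i (x.coord l)
  refine ⟨_, x, s, fun l b => ?_, fun b => ?_⟩
  · rw [hs, or_iff_not_imp_right, not_not]
    intro h
    rw [h, map_zero]
  · simp only [hs, Module.Basis.coord_apply]
    exact (x.sum_repr _).symm

theorem exists_proj_eq_sum_pairAt (hB : IsQuadraticPerm circB ω) (i : ℤ) :
    ∃ (n : ℕ) (x : Fin n → B i) (s : Fin n → ⨁ i, B i),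
      (∀ l, ∀ j ≠ i, (pairAt ω (s l) : _ →ₗ[k] P) ∘ₗ inc k (PB k P B) j = 0) ∧
      (∀ b, proj k B i b = ∑ l, ω b (s l) • x l) ∧
      proj k (PB k P B) i =
        ∑ l, (TensorProduct.mk k P (B i)).flip (x l) ∘ₗ pairAt ω (s l) := by
  obtain ⟨n, x, s, h0, hx⟩ := exists_proj_eq_sum hB i
  refine ⟨n, x, s, fun l j hj => TensorProduct.ext' fun p y => ?_, hx,
    linearMap_ext_tmul fun p b => ?_⟩
  · change pairAt ω (s l) (inc k (PB k P B) j (p ⊗ₜ y)) = 0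
    rw [inc_tmul, pairAt_tmul, (h0 l _).resolve_right (by rw [proj_inc_ne hj, ne_eq, not_not]),
      zero_smul]
  · rw [proj_distrib, hx, TensorProduct.tmul_sum, LinearMap.sum_apply]
    refine Finset.sum_congr rfl fun l _ => ?_
    rw [LinearMap.comp_apply, pairAt_tmul, LinearMap.flip_apply, TensorProduct.mk_apply,
      TensorProduct.tmul_smul, TensorProduct.smul_tmul']

/-- The extension of `(p ⊗ b) ⊗ (q ⊗ c) ↦ ω(b, s) ω(c, t) p ⊗ q` to the completed tensor
square. -/
def pairTwo (ω : (⨁ i, B i) →ₗ[k] (⨁ i, B i) →ₗ[k] k) (s t : ⨁ i, B i) :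
    CTwo k (PB k P B) →ₗ[k] P ⊗[k] P :=
  contrTwo (pairAt ω s) (pairAt ω t)

/-- The analogue of `pairTwo` for the completed tensor cube. -/
def pairThree (ω : (⨁ i, B i) →ₗ[k] (⨁ i, B i) →ₗ[k] k) (s t r : ⨁ i, B i) :
    CThree k (PB k P B) →ₗ[k] P ⊗[k] (P ⊗[k] P) :=
  contrThree (pairAt ω s) (pairAt ω t) (pairAt ω r)

/-- Each component of a completed tensor is a finite combination of its contractions. -/
theorem contrTwo_proj_proj_eq (hB : IsQuadraticPerm circB ω) (i j : ℤ) :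
    ∃ (n m : ℕ) (x : Fin n → B i) (y : Fin m → B j) (s : Fin n → ⨁ i, B i)
      (t : Fin m → ⨁ i, B i), ∀ X : CTwo k (PB k P B),
      contrTwo (proj k _ i) (proj k _ j) X = ∑ l, ∑ l', TensorProduct.map
        ((TensorProduct.mk k P (B i)).flip (x l)) ((TensorProduct.mk k P (B j)).flip (y l'))
        (pairTwo ω (s l) (t l') X) := by
  obtain ⟨n, x, s, -, -, hx⟩ := exists_proj_eq_sum_pairAt (P := P) hB i
  obtain ⟨m, y, t, -, -, hy⟩ := exists_proj_eq_sum_pairAt (P := P) hB j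
  refine ⟨n, m, x, y, s, t, fun X => ?_⟩
  have h := fun u => finSupp_pairAt (P := P) hB u
  rw [hx, hy, contrTwo_sum_left _ (fun l _ => (h _).comp _) (finSupp_sum _ fun l _ => (h _).comp _)]
  refine Finset.sum_congr rfl fun l _ => ?_
  rw [contrTwo_sum_right _ ((h _).comp _) fun l' _ => (h _).comp _]
  exact Finset.sum_congr rfl fun l' _ => contrTwo_comp (h _) (h _) _ _ X

/-- Contractions with the form of `B` separate the points of the completed tensor square. -/
theorem pairTwo_ext (hB : IsQuadraticPerm circB ω) {X Y : CTwo k (PB k P B)}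
    (h : ∀ s t, pairTwo ω s t X = pairTwo ω s t Y) : X = Y := by
  funext i j
  obtain ⟨n, m, x, y, s, t, hst⟩ := contrTwo_proj_proj_eq (P := P) hB i j
  rw [← contrTwo_proj i j X, ← contrTwo_proj i j Y, hst, hst]
  simp only [h]

theorem pairThree_ext (hB : IsQuadraticPerm circB ω) {X Y : CThree k (PB k P B)}
    (h : ∀ s t r, pairThree ω s t r X = pairThree ω s t r Y) : X = Y := by
  have hid : ∀ i : ℤ, ∃ (n : ℕ) (f : Fin n → P →ₗ[k] PB k P B i) (s : Fin n → ⨁ i, B i),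
      (∀ l, ∀ j ∉ ({i} : Finset ℤ), (pairAt ω (s l) : _ →ₗ[k] P) ∘ₗ inc k (PB k P B) j = 0) ∧
      LinearMap.id = ∑ l, f l ∘ₗ (pairAt ω (s l) ∘ₗ inc k (PB k P B) i) := by
    intro i
    obtain ⟨n, x, s, h0, -, hx⟩ := exists_proj_eq_sum_pairAt (P := P) hB i
    refine ⟨n, fun l => (TensorProduct.mk k P (B i)).flip (x l), s,
      fun l j hj => h0 l j (by simpa using hj), ?_⟩
    rw [← proj_comp_inc_self, hx, sum_comp_linearMap]
    rfl
  funext a b c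
  obtain ⟨n, f, s, hs, hf⟩ := hid a
  obtain ⟨n', g, t, ht, hg⟩ := hid b
  obtain ⟨n'', e, r, hr, he⟩ := hid c
  have key : ∀ X : CThree k (PB k P B), X a b c = ∑ l, ∑ l', ∑ l'', TensorProduct.map (f l)
      (TensorProduct.map (g l') (e l'')) (pairThree ω (s l) (t l') (r l'') X) := by
    intro X
    have h1 : X a b c = TensorProduct.map LinearMap.id
        (TensorProduct.map LinearMap.id LinearMap.id) (X a b c) := by
      rw [TensorProduct.map_id, TensorProduct.map_id, LinearMap.id_apply]
    rw [h1, hf, hg, he, map_sum_left]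
    refine Finset.sum_congr rfl fun l _ => ?_
    have h2 : TensorProduct.map (∑ l, g l ∘ₗ (pairAt ω (t l) ∘ₗ inc k (PB k P B) b))
        (∑ l, e l ∘ₗ (pairAt ω (r l) ∘ₗ inc k (PB k P B) c)) =
        ∑ l', ∑ l'', TensorProduct.map (g l' ∘ₗ (pairAt ω (t l') ∘ₗ inc k (PB k P B) b))
          (e l'' ∘ₗ (pairAt ω (r l'') ∘ₗ inc k (PB k P B) c)) := by
      refine LinearMap.ext fun z => ?_
      rw [map_sum_left, LinearMap.sum_apply]
      refine Finset.sum_congr rfl fun l' _ => ?_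
      rw [map_sum_right, LinearMap.sum_apply]
    rw [h2, map_sum_right]
    refine Finset.sum_congr rfl fun l' _ => ?_
    rw [map_sum_right]
    refine Finset.sum_congr rfl fun l'' _ => ?_
    rw [pairThree, contrThree_apply (hs l) (ht l') (hr l''), Finset.sum_singleton,
      Finset.sum_singleton, Finset.sum_singleton, TensorProduct.map_comp, TensorProduct.map_comp,
      LinearMap.comp_apply]
  rw [key X, key Y]
  simp only [h]

/-! ### Contractions of products and coproducts -/

/-- Left multiplications of `B` are self-adjoint for `ω`. By invariance the adjoint of the right
multiplication by `b` is the commutator with `b`. -/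
theorem omega_mul_left (hB : IsQuadraticPerm circB ω) (a b c : ⨁ i, B i) :
    ω (circB a b) c = ω b (circB a c) := by
  have h1 := hB.invariant a b c
  have h2 := hB.invariant a c b
  rw [map_sub] at h1 h2
  rw [h1, hB.skew b, h2, neg_sub]

theorem omega_mul_right (hB : IsQuadraticPerm circB ω) (b s t : ⨁ i, B i) :
    ω t (circB s b) = -ω b (circB s t) := by
  rw [← omega_mul_left hB, hB.skew]

theorem omega_commutator (hB : IsQuadraticPerm circB ω) (b s t : ⨁ i, B i) :
    ω (circB b t - circB t b) s = -ω b (circB s t) := by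
  rw [map_sub, LinearMap.sub_apply, omega_mul_left hB t b, hB.invariant, map_sub]
  abel

theorem pairAt_comp_left (hB : IsQuadraticPerm circB ω) (m : Op k P) (p : P) (b s : ⨁ i, B i) :
    pairAt ω s ∘ₗ indOp m circB (distrib k P B (p ⊗ₜ b)) = m p ∘ₗ pairAt ω (circB b s) :=
  linearMap_ext_tmul fun q c => by
    rw [LinearMap.comp_apply, LinearMap.comp_apply, indOp_tmul, pairAt_tmul, pairAt_tmul, map_smul,
      omega_mul_left hB]

theorem pairAt_comp_right (hB : IsQuadraticPerm circB ω) (m : Op k P) (p : P)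
    (b s : ⨁ i, B i) :
    pairAt ω s ∘ₗ (indOp m circB).flip (distrib k P B (p ⊗ₜ b)) =
      m.flip p ∘ₗ pairAt ω (circB b s - circB s b) :=
  linearMap_ext_tmul fun q c => by
    rw [LinearMap.comp_apply, LinearMap.comp_apply, LinearMap.flip_apply, indOp_tmul, pairAt_tmul,
      pairAt_tmul, map_smul, hB.invariant, LinearMap.flip_apply]

theorem isGradedOp_indOp (hB : IsGradedOp circB) (m : Op k P) : IsGradedOp (indOp m circB) := by
  intro i j x y
  induction x using TensorProduct.induction_on with
  | zero => exact ⟨0, by simp⟩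
  | add x x' hx hx' =>
    obtain ⟨z, hz⟩ := hx
    obtain ⟨z', hz'⟩ := hx'
    exact ⟨z + z', by rw [map_add, map_add, map_add, LinearMap.add_apply, hz, hz']⟩
  | tmul p b =>
    induction y using TensorProduct.induction_on with
    | zero => exact ⟨0, by simp⟩
    | add y y' hy hy' =>
      obtain ⟨z, hz⟩ := hy
      obtain ⟨z', hz'⟩ := hy'
      exact ⟨z + z', by rw [map_add, map_add, map_add, hz, hz']⟩
    | tmul q c =>
      obtain ⟨d, hd⟩ := hB i j b c
      exact ⟨m p q ⊗ₜ d, by rw [inc_tmul, inc_tmul, indOp_tmul, hd, inc_tmul]⟩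

section PairTwo

variable (hB : IsQuadraticPerm circB ω) (m : Op k P)
include hB

theorem locFin_indOp : LocFin (indOp m circB) :=
  (isGradedOp_indOp hB.alg.graded m).locFin

theorem pairTwo_hatTau (s t : ⨁ i, B i) (X : CTwo k (PB k P B)) :
    pairTwo ω s t (hatTau X) = tau k P (pairTwo ω t s X) :=
  contrTwo_hatTau (finSupp_pairAt hB s) (finSupp_pairAt hB t) X

theorem pairThree_hatTau12 (s t r : ⨁ i, B i) (X : CThree k (PB k P B)) :
    pairThree ω s t r (hatTau12 X) = tau12 k P (pairThree ω t s r X) :=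
  contrThree_hatTau12 (finSupp_pairAt hB s) (finSupp_pairAt hB t) (finSupp_pairAt hB r) X

theorem contrTwo_comp_pairAt (f g : P →ₗ[k] P) (s t : ⨁ i, B i) (X : CTwo k (PB k P B)) :
    contrTwo (f ∘ₗ pairAt ω s) (g ∘ₗ pairAt ω t) X = TensorProduct.map f g (pairTwo ω s t X) :=
  contrTwo_comp (finSupp_pairAt hB s) (finSupp_pairAt hB t) f g X

theorem pairTwo_hatL_left (p : P) (b s t : ⨁ i, B i) (X : CTwo k (PB k P B)) :
    pairTwo ω s t (hatL (indOp m circB (distrib k P B (p ⊗ₜ b))) X) =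
      actL (m p) (pairTwo ω (circB b s) t X) := by
  have := locFin_indOp hB m
  rw [pairTwo, contrTwo_hatL (finSupp_pairAt hB s) (finSupp_pairAt hB t), pairAt_comp_left hB]
  exact contrTwo_comp_pairAt hB (m p) LinearMap.id _ _ X

theorem pairTwo_hatL_right (p : P) (b s t : ⨁ i, B i) (X : CTwo k (PB k P B)) :
    pairTwo ω s t (hatL ((indOp m circB).flip (distrib k P B (p ⊗ₜ b))) X) =
      actL (m.flip p) (pairTwo ω (circB b s - circB s b) t X) := by
  have := locFin_indOp hB m
  rw [pairTwo, contrTwo_hatL (finSupp_pairAt hB s) (finSupp_pairAt hB t), pairAt_comp_right hB]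
  exact contrTwo_comp_pairAt hB (m.flip p) LinearMap.id _ _ X

theorem pairTwo_hatR_left (p : P) (b s t : ⨁ i, B i) (X : CTwo k (PB k P B)) :
    pairTwo ω s t (hatR (indOp m circB (distrib k P B (p ⊗ₜ b))) X) =
      actR (m p) (pairTwo ω s (circB b t) X) := by
  have := locFin_indOp hB m
  rw [pairTwo, contrTwo_hatR (finSupp_pairAt hB s) (finSupp_pairAt hB t), pairAt_comp_left hB]
  exact contrTwo_comp_pairAt hB LinearMap.id (m p) _ _ X

theorem pairTwo_hatR_right (p : P) (b s t : ⨁ i, B i) (X : CTwo k (PB k P B)) :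
    pairTwo ω s t (hatR ((indOp m circB).flip (distrib k P B (p ⊗ₜ b))) X) =
      actR (m.flip p) (pairTwo ω s (circB b t - circB t b) X) := by
  have := locFin_indOp hB m
  rw [pairTwo, contrTwo_hatR (finSupp_pairAt hB s) (finSupp_pairAt hB t), pairAt_comp_right hB]
  exact contrTwo_comp_pairAt hB LinearMap.id (m.flip p) _ _ X

theorem pairTwo_bullet (s t : ⨁ i, B i) (X : P ⊗[k] P) (Y : CTwo k B) :
    pairTwo ω s t (bullet X Y) = omegaHat ω Y s t • X := by
  classical
  obtain ⟨m, hm⟩ := hB.graded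
  obtain ⟨S, hS⟩ := finSupp_pairAt (P := P) hB s
  obtain ⟨T, hT⟩ := finSupp_pairAt (P := P) hB t
  have hfin := pairBlock_finite hm Y s t
  -- One finite set of degrees serves both the contraction and the sum defining `omegaHat`.
  let S' := S ∪ hfin.toFinset.image Prod.fst
  let T' := T ∪ hfin.toFinset.image Prod.snd
  rw [pairTwo, contrTwo_apply (S := S') (T := T')
    (fun i hi => hS i fun h => hi (Finset.mem_union_left _ h))
    (fun i hi => hT i fun h => hi (Finset.mem_union_left _ h)), omegaHat,
    finsum_eq_sum_of_support_subset (s := S' ×ˢ T'), Finset.sum_product, Finset.sum_smul]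
  · refine Finset.sum_congr rfl fun i _ => ?_
    rw [Finset.sum_smul]
    refine Finset.sum_congr rfl fun j _ => ?_
    change TensorProduct.map (pairAt ω s ∘ₗ inc k (PB k P B) i) (pairAt ω t ∘ₗ inc k (PB k P B) j)
      (TensorProduct.tensorTensorTensorComm k P P (B i) (B j) (X ⊗ₜ[k] Y i j)) =
      pairBlock ω s t i j (Y i j) • X
    induction Y i j using TensorProduct.induction_on with
    | zero => simp
    | add x y hx hy => simp only [TensorProduct.tmul_add, map_add, hx, hy, add_smul]
    | tmul x y =>
      induction X using TensorProduct.induction_on with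
      | zero => simp
      | add x y hx hy => simp only [TensorProduct.add_tmul, map_add, hx, hy, smul_add]
      | tmul p q =>
        change pairAt ω s (inc k (PB k P B) i (p ⊗ₜ x)) ⊗ₜ
          pairAt ω t (inc k (PB k P B) j (q ⊗ₜ y)) = (ω (inc k B i x) s * ω (inc k B j y) t) • p ⊗ₜ[k] q
        rw [inc_tmul, inc_tmul, pairAt_tmul, pairAt_tmul, TensorProduct.smul_tmul_smul]
  · intro ij hij
    rw [Finset.coe_product]
    have h : ij ∈ hfin.toFinset := hfin.mem_toFinset.2 hij
    exact ⟨Finset.mem_union_right _ (Finset.mem_image_of_mem _ h),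
      Finset.mem_union_right _ (Finset.mem_image_of_mem _ h)⟩

theorem pairTwo_indCo (D : P →ₗ[k] P ⊗[k] P) (s t b : ⨁ i, B i) (p : P) :
    pairTwo ω s t (indCo D (nuOmega hB) (distrib k P B (p ⊗ₜ b))) = -(ω b (circB s t) • D p) := by
  rw [indCo_tmul, pairTwo_bullet hB, nuOmega_spec, neg_smul]

/-- The coproduct `ν_ω` is dual to the product of `B`: contracting an induced coproduct with
`s` and `t` is the same as contracting with `s ∘ t` first. -/
theorem pairTwo_comp_indCo (D : P →ₗ[k] P ⊗[k] P) (s t : ⨁ i, B i) :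
    pairTwo ω s t ∘ₗ indCo D (nuOmega hB) = (-D) ∘ₗ pairAt ω (circB s t) :=
  linearMap_ext_tmul fun p b => by
    rw [LinearMap.comp_apply, LinearMap.comp_apply, pairTwo_indCo, pairAt_tmul, LinearMap.neg_apply,
      map_smul]

theorem pairTwo_indCo' (D : P →ₗ[k] P ⊗[k] P) (s t : ⨁ i, B i) (v : ⨁ i, PB k P B i) :
    pairTwo ω s t (indCo D (nuOmega hB) v) = -D (pairAt ω (circB s t) v) :=
  LinearMap.congr_fun (pairTwo_comp_indCo hB D s t) v

theorem finCo_indCo (D : P →ₗ[k] P ⊗[k] P) : FinCo (indCo D (nuOmega hB)) := by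
  intro i j
  obtain ⟨n, n', x, y, s, t, hst⟩ := contrTwo_proj_proj_eq (P := P) hB i j
  have h : contrTwo (proj k (PB k P B) i) (proj k (PB k P B) j) ∘ₗ indCo D (nuOmega hB) =
      ∑ l, ∑ l', TensorProduct.map ((TensorProduct.mk k P (B i)).flip (x l))
        ((TensorProduct.mk k P (B j)).flip (y l')) ∘ₗ (-D) ∘ₗ
          pairAt ω (circB (s l) (t l')) := by
    refine LinearMap.ext fun v => ?_
    simp only [LinearMap.comp_apply, hst, LinearMap.sum_apply, pairTwo_indCo', LinearMap.neg_apply]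
  rw [h]
  exact finSupp_sum _ fun l _ => finSupp_sum _ fun l' _ =>
    ((finSupp_pairAt hB _).comp _).comp _

theorem pairThree_hatCoL (D E : P →ₗ[k] P ⊗[k] P) (s t r : ⨁ i, B i) (v : ⨁ i, PB k P B i) :
    pairThree ω s t r (hatCoL (indCo D (nuOmega hB)) (indCo E (nuOmega hB)) v) =
      coL D E (pairAt ω (circB (circB s t) r) v) := by
  have h := fun u => finSupp_pairAt (P := P) hB u
  rw [pairThree, contrThree_hatCoL (finCo_indCo hB D) (h s) (h t) (h r)]
  change TensorProduct.assoc k P P P (contrTwo (pairTwo ω s t ∘ₗ indCo D (nuOmega hB)) _ _) = _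
  have h' := contrTwo_comp (h (circB s t)) (h r) (-D) LinearMap.id (indCo E (nuOmega hB) v)
  rw [LinearMap.id_comp] at h'
  rw [pairTwo_comp_indCo, h']
  change TensorProduct.assoc k P P P (LinearMap.rTensor P (-D) (pairTwo ω _ _ _)) = _
  rw [pairTwo_indCo', LinearMap.rTensor_neg, LinearMap.neg_apply, map_neg, map_neg, map_neg,
    neg_neg]
  rfl

theorem pairThree_hatCoR (D E : P →ₗ[k] P ⊗[k] P) (s t r : ⨁ i, B i) (v : ⨁ i, PB k P B i) :
    pairThree ω s t r (hatCoR (indCo D (nuOmega hB)) (indCo E (nuOmega hB)) v) =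
      coR D E (pairAt ω (circB s (circB t r)) v) := by
  have h := fun u => finSupp_pairAt (P := P) hB u
  rw [pairThree, contrThree_hatCoR (finCo_indCo hB D) (h s) (h t) (h r)]
  change contrTwo _ (pairTwo ω t r ∘ₗ indCo D (nuOmega hB)) _ = _
  have h' := contrTwo_comp (h s) (h (circB t r)) LinearMap.id (-D) (indCo E (nuOmega hB) v)
  rw [LinearMap.id_comp] at h'
  rw [pairTwo_comp_indCo, h']
  change LinearMap.lTensor P (-D) (pairTwo ω _ _ _) = _
  rw [pairTwo_indCo', LinearMap.lTensor_neg, LinearMap.neg_apply, map_neg, neg_neg]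
  rfl

end PairTwo

end Pairing


/-! ### The induced completed dual pre-Poisson bialgebra -/

section Bialgebra

variable {k : Type u} [Field k]
variable {P : Type w} [AddCommGroup P] [Module k P]
variable {B : ℤ → Type v} [∀ i, AddCommGroup (B i)] [∀ i, Module k (B i)]
variable {circB : Op k (⨁ i, B i)} {ω : (⨁ i, B i) →ₗ[k] (⨁ i, B i) →ₗ[k] k}

/-- Two biadditive functions on `P ⊗ B` agree if they agree on pure tensors. -/
theorem eq_of_tmul {M : Type*} [AddCommGroup M]
    {F G : (⨁ i, PB k P B i) → (⨁ i, PB k P B i) → M}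
    (hadd : (∀ a a' b, F (a + a') b - G (a + a') b = (F a b - G a b) + (F a' b - G a' b)) ∧
      ∀ a b b', F a (b + b') - G a (b + b') = (F a b - G a b) + (F a b' - G a b'))
    (h : ∀ p b q c, F (distrib k P B (p ⊗ₜ b)) (distrib k P B (q ⊗ₜ c)) =
      G (distrib k P B (p ⊗ₜ b)) (distrib k P B (q ⊗ₜ c)))
    (a b : ⨁ i, PB k P B i) : F a b = G a b := by
  obtain ⟨hl, hr⟩ := hadd
  rw [← sub_eq_zero]
  induction a using induction_tmul with
  | zero => simpa using hl 0 0 b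
  | add a a' ha ha' => rw [hl, ha, ha', add_zero]
  | tmul p b' =>
    induction b using induction_tmul with
    | zero => simpa using hr (distrib k P B (p ⊗ₜ b')) 0 0
    | add b b' hb hb' => rw [hr, hb, hb', add_zero]
    | tmul q c => rw [sub_eq_zero, h]

/-! ### Scalar parts of the induced operations -/

section Scalars

/-- The quadrilinear form `ω(c, b ∘ (s ∘ t))`. Every scalar occurring in the compatibility
conditions is one of its values, with arguments permuted. -/
def quadForm (circB : Op k (⨁ i, B i)) (ω : (⨁ i, B i) →ₗ[k] (⨁ i, B i) →ₗ[k] k)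
    (b c s t : ⨁ i, B i) : k :=
  ω c (circB b (circB s t))

variable (hB : IsQuadraticPerm circB ω) (b c s t : ⨁ i, B i)
include hB

theorem mul_left_comm' (a b c : ⨁ i, B i) : circB a (circB b c) = circB b (circB a c) := by
  rw [hB.alg.perm.assoc, hB.alg.perm.perm, hB.alg.perm.assoc]

theorem quadForm_swap : quadForm circB ω c b s t = quadForm circB ω b c s t -
    ω c (circB s (circB t b)) := by
  rw [quadForm, quadForm, ← omega_mul_left hB, hB.invariant, map_sub, ← hB.alg.perm.assoc]

/-- The only linear relation among the values of `quadForm` that the compatibility conditions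
need; both differences equal `ω(c, s ∘ (t ∘ b))`. -/
theorem quadForm_rel : quadForm circB ω c b t s = quadForm circB ω b c t s -
    quadForm circB ω b c s t + quadForm circB ω c b s t := by
  rw [quadForm_swap hB b c t s, quadForm_swap hB b c s t, mul_left_comm' hB t s b]
  ring

variable (m : Op k P) (D : P →ₗ[k] P ⊗[k] P) (p q : P)

theorem pairTwo_indCo_mul :
    pairTwo ω s t (indCo D (nuOmega hB)
      (indOp m circB (distrib k P B (p ⊗ₜ b)) (distrib k P B (q ⊗ₜ c)))) =
      -(quadForm circB ω b c s t • D (m p q)) := by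
  rw [indOp_tmul, pairTwo_indCo, omega_mul_left hB, quadForm]

theorem pairTwo_hatL_left_indCo :
    pairTwo ω s t (hatL (indOp m circB (distrib k P B (p ⊗ₜ b)))
      (indCo D (nuOmega hB) (distrib k P B (q ⊗ₜ c)))) =
      -(quadForm circB ω b c s t • actL (m p) (D q)) := by
  rw [pairTwo_hatL_left hB, pairTwo_indCo, ← hB.alg.perm.assoc, map_neg, map_smul, quadForm]

/-- The adjoint of `R(b)` takes values in commutators, which are killed by the left multiplication
in a perm algebra, so this term vanishes. -/
theorem pairTwo_hatL_right_indCo :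
    pairTwo ω s t (hatL ((indOp m circB).flip (distrib k P B (p ⊗ₜ b)))
      (indCo D (nuOmega hB) (distrib k P B (q ⊗ₜ c)))) = 0 := by
  rw [pairTwo_hatL_right hB, pairTwo_indCo, map_sub, LinearMap.sub_apply, hB.alg.perm.perm b s,
    sub_self, map_zero, zero_smul, neg_zero, map_zero]

theorem pairTwo_hatR_left_indCo :
    pairTwo ω s t (hatR (indOp m circB (distrib k P B (p ⊗ₜ b)))
      (indCo D (nuOmega hB) (distrib k P B (q ⊗ₜ c)))) =
      -(quadForm circB ω b c s t • actR (m p) (D q)) := by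
  rw [pairTwo_hatR_left hB, pairTwo_indCo, mul_left_comm' hB, map_neg, map_smul, quadForm]

theorem pairTwo_hatR_right_indCo :
    pairTwo ω s t (hatR ((indOp m circB).flip (distrib k P B (p ⊗ₜ b)))
      (indCo D (nuOmega hB) (distrib k P B (q ⊗ₜ c)))) =
      -(quadForm circB ω c b s t • actR (m.flip p) (D q)) := by
  rw [pairTwo_hatR_right hB, pairTwo_indCo, quadForm_swap hB, map_neg, map_smul, quadForm, map_sub,
    map_sub, mul_left_comm' hB s b]

end Scalars

/-! ### The dual pre-Poisson algebra -/

/-- Two triadditive functions on `P ⊗ B` agree if they agree on pure tensors. -/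
theorem eq_of_tmul₃ {M : Type*} [AddCommGroup M]
    {F G : (⨁ i, PB k P B i) → (⨁ i, PB k P B i) → (⨁ i, PB k P B i) → M}
    (hadd : (∀ a a' b c, F (a + a') b c - G (a + a') b c =
        (F a b c - G a b c) + (F a' b c - G a' b c)) ∧
      (∀ a b b' c, F a (b + b') c - G a (b + b') c =
        (F a b c - G a b c) + (F a b' c - G a b' c)) ∧
      ∀ a b c c', F a b (c + c') - G a b (c + c') =
        (F a b c - G a b c) + (F a b c' - G a b c'))
    (h : ∀ p b q c r d,
      F (distrib k P B (p ⊗ₜ b)) (distrib k P B (q ⊗ₜ c)) (distrib k P B (r ⊗ₜ d)) =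
        G (distrib k P B (p ⊗ₜ b)) (distrib k P B (q ⊗ₜ c)) (distrib k P B (r ⊗ₜ d)))
    (a b c : ⨁ i, PB k P B i) : F a b c = G a b c := by
  obtain ⟨hl, hm, hr⟩ := hadd
  refine eq_of_tmul (F := fun a b => F a b c) (G := fun a b => G a b c)
    ⟨fun a a' b => hl a a' b c, fun a b b' => hm a b b' c⟩ (fun p b q d => ?_) a b
  rw [← sub_eq_zero]
  induction c using induction_tmul with
  | zero => simpa using hr (distrib k P B (p ⊗ₜ b)) (distrib k P B (q ⊗ₜ d)) 0 0
  | add c c' hc hc' => rw [hr, hc, hc', add_zero]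
  | tmul r e => rw [sub_eq_zero, h]

variable {mul br : Op k P} {Δ δ : P →ₗ[k] P ⊗[k] P}

theorem IsPoissonAlgebra.mul_flip (h : IsPoissonAlgebra mul br) : mul.flip = mul :=
  LinearMap.ext₂ fun p q => h.mul_comm q p

theorem IsPoissonAlgebra.br_flip (h : IsPoissonAlgebra mul br) : br.flip = -br :=
  LinearMap.ext₂ fun p q => h.br_skew q p

theorem isDPPAlgebra_ind (hP : IsPoissonAlgebra mul br) (hB : IsPerm circB) :
    IsDPPAlgebra (indOp mul circB) (indOp br circB) := by
  have hcomm : ∀ b c d, circB c (circB b d) = circB b (circB c d) := fun b c d => by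
    rw [hB.assoc, hB.perm, hB.assoc]
  refine ⟨⟨?_, ?_⟩, ?_, ?_, ?_, ?_⟩
  all_goals
    refine eq_of_tmul₃ ⟨?_, ?_, ?_⟩ fun p b q c r d => ?_
    iterate 3
      · intros
        simp only [map_add, LinearMap.add_apply]
        abel
    -- All terms have the second component `b ∘ (c ∘ d)`; the first components remain.
    simp only [indOp_tmul, ← hB.assoc, hcomm b c, ← map_add, ← map_sub, ← map_neg,
      ← TensorProduct.add_tmul, ← TensorProduct.sub_tmul, ← TensorProduct.neg_tmul]
    congr 2
  · rw [hP.mul_assoc]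
  · rw [hP.mul_comm p q]
  · have h := hP.jacobi p q r
    rw [hP.br_skew r (br p q), hP.br_skew r p, map_neg] at h
    linear_combination (norm := module) h
  · rw [hP.br_skew (mul p q) r, hP.leibniz, hP.br_skew q r, hP.br_skew p r, map_neg,
      map_neg, hP.mul_comm _ q]
    abel
  · rw [hP.leibniz]
    abel
  · rw [map_neg, hP.br_skew p q, map_neg, LinearMap.neg_apply]

theorem isGradedDPPAlgebra_ind [FiniteDimensional k P] (hP : IsPoissonAlgebra mul br)
    (hB : IsGradedPerm circB) : IsGradedDPPAlgebra (indOp mul circB) (indOp br circB) where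
  finite i := by
    have := hB.finite i
    infer_instance
  alg := isDPPAlgebra_ind hP hB.perm
  graded_circ := isGradedOp_indOp hB.graded mul
  graded_ast := isGradedOp_indOp hB.graded br

/-! ### The completed dual pre-Poisson coalgebra -/

/-- The cyclic permutation `x ⊗ y ⊗ z ↦ y ⊗ z ⊗ x` of three spaces. -/
def rotate (k : Type u) [Field k] (X Y Z : Type*) [AddCommGroup X] [Module k X]
    [AddCommGroup Y] [Module k Y] [AddCommGroup Z] [Module k Z] :
    X ⊗[k] (Y ⊗[k] Z) ≃ₗ[k] Y ⊗[k] (Z ⊗[k] X) :=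
  TensorProduct.comm k X (Y ⊗[k] Z) ≪≫ₗ TensorProduct.assoc k Y Z X

theorem tau12_coL (f g : P →ₗ[k] P ⊗[k] P) (w : P) :
    tau12 k P (coL f g w) = coL (tau k P ∘ₗ f) g w := by
  rw [coL, coL, LinearMap.comp_apply, LinearMap.comp_apply, LinearMap.comp_apply,
    LinearMap.comp_apply]
  induction g w using TensorProduct.induction_on with
  | zero => simp
  | add x y hx hy => simp only [map_add, hx, hy]
  | tmul x y =>
    rw [LinearMap.rTensor_tmul, LinearMap.rTensor_tmul, LinearMap.comp_apply]
    induction f x using TensorProduct.induction_on with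
    | zero => simp
    | add x y hx hy => simp only [map_add, TensorProduct.add_tmul, hx, hy]
    | tmul x y => rfl

theorem coL_tau (f g : P →ₗ[k] P ⊗[k] P) (w : P) :
    coL f (tau k P ∘ₗ g) w = rotate k P P P (coR f g w) := by
  rw [coL, coR, LinearMap.comp_apply, LinearMap.comp_apply, LinearMap.comp_apply,
    LinearMap.comp_apply]
  induction g w using TensorProduct.induction_on with
  | zero => simp
  | add x y hx hy => simp only [map_add, hx, hy]
  | tmul x y => rfl

theorem rotate_coL_tau (f g : P →ₗ[k] P ⊗[k] P) (w : P) :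
    rotate k P P P (coL f (tau k P ∘ₗ g) w) = tau12 k P (coR (tau k P ∘ₗ f) g w) := by
  rw [coL_tau, coR, coR, LinearMap.comp_apply, LinearMap.comp_apply]
  induction g w using TensorProduct.induction_on with
  | zero => simp
  | add x y hx hy => simp only [map_add, hx, hy]
  | tmul x y =>
    rw [LinearMap.lTensor_tmul, LinearMap.lTensor_tmul, LinearMap.comp_apply]
    induction f y using TensorProduct.induction_on with
    | zero => simp
    | add x y hx hy => simp only [map_add, TensorProduct.tmul_add, hx, hy]
    | tmul x y => rfl

theorem rotate_tau12_coR (f g : P →ₗ[k] P ⊗[k] P) (w : P) :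
    rotate k P P P (tau12 k P (coR f g w)) = coR (tau k P ∘ₗ f) g w := by
  rw [coR, coR, LinearMap.comp_apply, LinearMap.comp_apply]
  induction g w using TensorProduct.induction_on with
  | zero => simp
  | add x y hx hy => simp only [map_add, hx, hy]
  | tmul x y =>
    rw [LinearMap.lTensor_tmul, LinearMap.lTensor_tmul, LinearMap.comp_apply]
    induction f y using TensorProduct.induction_on with
    | zero => simp
    | add x y hx hy => simp only [map_add, TensorProduct.tmul_add, hx, hy]
    | tmul x y => rfl

theorem coR_neg (f g : P →ₗ[k] P ⊗[k] P) (w : P) : coR (-f) g w = -coR f g w := by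
  rw [coR, LinearMap.lTensor_neg]
  rfl

theorem coL_neg (f g : P →ₗ[k] P ⊗[k] P) (w : P) : coL f (-g) w = -coL f g w := by
  rw [coL, LinearMap.comp_neg, LinearMap.comp_neg]
  rfl

theorem coL_neg' (f g : P →ₗ[k] P ⊗[k] P) (w : P) : coL (-f) g w = -coL f g w := by
  rw [coL, LinearMap.rTensor_neg, LinearMap.neg_comp, LinearMap.comp_neg]
  rfl

/-- The dual of the identity `[ab, c] = a[b, c] + b[a, c]`. -/
theorem IsPoissonCoalgebra.coL_Delta_delta (h : IsPoissonCoalgebra Δ δ) (w : P) :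
    coL Δ δ w = coR δ Δ w + tau12 k P (coR δ Δ w) := by
  have h1 := coL_tau Δ δ w
  have h2 := congr_arg (rotate k P P P) (LinearMap.congr_fun h.coleibniz w)
  have h3 := rotate_coL_tau δ Δ w
  have h4 := rotate_tau12_coR δ Δ w
  rw [h.coskew, coL_neg] at h1
  rw [h.cocomm, h.coskew, coR_neg, map_neg] at h3
  rw [h.coskew, coR_neg] at h4
  rw [LinearMap.add_apply, LinearMap.comp_apply, map_add, h3, h4, ← h1] at h2
  rw [← neg_inj, h2]
  abel

theorem isCompletedDPPCoalgebra_ind (hP : IsPoissonCoalgebra Δ δ) (hB : IsQuadraticPerm circB ω) :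
    IsCompletedDPPCoalgebra (indCo Δ (nuOmega hB)) (indCo δ (nuOmega hB)) := by
  have hν := finCo_indCo hB Δ
  have hθ := finCo_indCo hB δ
  refine ⟨⟨hν.composable, ?_, ?_⟩, ⟨hθ.composable, ?_⟩, hν.composable, hθ.composable, ?_, ?_, ?_⟩
  -- The scalar part of every term is `ω(b, s ∘ (t ∘ r))`, which is symmetric in `s` and `t`.
  all_goals
    intro v
    refine pairThree_ext hB fun s t r => ?_
    simp only [map_add, map_neg, pairThree_hatTau12 hB, pairThree_hatCoL hB, pairThree_hatCoR hB,
      hB.alg.perm.assoc, hB.alg.perm.perm t s]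
    generalize pairAt ω (circB (circB s t) r) v = w
  · rw [hP.coassoc]
  · rw [tau12_coL, hP.cocomm]
  · rw [← hP.cojacobi, LinearMap.sub_apply, LinearMap.comp_apply, sub_add_cancel]
  · rw [hP.coleibniz]
    rfl
  · exact hP.coL_Delta_delta w
  · rw [tau12_coL, hP.coskew, coL_neg', neg_neg]

/-! ### The compatibility conditions -/

theorem tau_actL (f : P →ₗ[k] P) (X : P ⊗[k] P) : tau k P (actL f X) = actR f (tau k P X) := by
  induction X using TensorProduct.induction_on with
  | zero => simp
  | tmul x y => rfl
  | add x y hx hy => simp only [map_add, hx, hy]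

theorem tau_tau (X : P ⊗[k] P) : tau k P (tau k P X) = X :=
  (TensorProduct.comm k P P).symm_apply_apply X

theorem tau_actR (f : P →ₗ[k] P) (X : P ⊗[k] P) : tau k P (actR f X) = actL f (tau k P X) := by
  rw [← tau_tau X, ← tau_actL, tau_tau, tau_tau]

set_option maxHeartbeats 4000000 in
theorem isCompletedDPPBialgebra_ind [FiniteDimensional k P] (hP : IsPoissonBialgebra mul br Δ δ)
    (hB : IsQuadraticPerm circB ω) :
    IsCompletedDPPBialgebra (indOp mul circB) (indOp br circB) (indCo Δ (nuOmega hB))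
      (indCo δ (nuOmega hB)) := by
  have := locFin_indOp hB mul
  have := locFin_indOp hB br
  have hΔ : ∀ p, tau k P (Δ p) = Δ p := LinearMap.congr_fun hP.coalg.cocomm
  have hδ : ∀ p, tau k P (δ p) = -δ p := LinearMap.congr_fun hP.coalg.coskew
  have hinf' : ∀ p q, Δ (mul p q) = actL (mul p) (Δ q) + actR (mul q) (Δ p) := fun p q => by
    rw [hP.alg.mul_comm, hP.infinitesimal]
  have hskew : ∀ p q, Δ (br q p) = -Δ (br p q) := fun p q => by
    rw [hP.alg.br_skew q p, map_neg]
  -- The image of the formula for `δ(pq)` under the twist.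
  have hcompat' : ∀ p q, δ (mul p q) = actR (mul p) (δ q) + actR (mul q) (δ p) -
      actL (br p) (Δ q) - actL (br q) (Δ p) := fun p q => by
    have h := congr_arg (tau k P) (hP.compat₂ p q)
    simp only [map_add, tau_actL, tau_actR, hΔ, hδ, map_neg] at h
    rw [← neg_inj, h]
    abel
  refine ⟨isGradedDPPAlgebra_ind hP.alg hB.alg, isCompletedDPPCoalgebra_ind hP.coalg hB,
    ⟨?_, ?_, ?_⟩, ⟨?_, ?_⟩, ?_, ?_, ?_, ?_, ?_, ?_, ?_⟩
  all_goals
    refine eq_of_tmul ⟨?_, ?_⟩ fun p b q c => pairTwo_ext hB fun s t => ?_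
    iterate 2
      · intros
        simp only [map_add, LinearMap.add_apply, hatL_add_left, hatL_add_right, hatL_sub_left,
          hatL_sub_right, hatR_add_left, hatR_add_right, hatR_sub_left, hatR_sub_right]
        abel
    simp only [map_add, map_sub, map_neg, hatL_add_left, hatL_sub_left, hatL_add_right,
      hatL_sub_right, hatR_add_left, hatR_sub_left, hatR_add_right, hatR_sub_right,
      hatL_hatTau, hatR_hatTau, pairTwo_hatTau hB, pairTwo_indCo_mul hB,
      pairTwo_hatL_left_indCo hB, pairTwo_hatL_right_indCo hB, pairTwo_hatR_left_indCo hB,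
      pairTwo_hatR_right_indCo hB, hP.alg.mul_flip, hP.alg.br_flip, tau_actL, tau_actR, hΔ, hδ,
      map_smul, LinearMap.neg_apply, LinearMap.lTensor_neg, map_zero,
      quadForm_rel hB b c s t, neg_zero]
    -- What remains is an identity in `P ⊗ P` whose coefficients may be treated as unknowns.
    try
      generalize quadForm circB ω b c s t = x
      generalize quadForm circB ω b c t s = y
      generalize quadForm circB ω c b s t = z
  · linear_combination (norm := module) -x • hinf' p q
  · linear_combination (norm := module) -x • hP.infinitesimal p q
  · linear_combination (norm := module) -x • hP.lieBialg p q
  · linear_combination (norm := module) -x • hP.compat₁ p q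
  · linear_combination (norm := module) -x • hcompat' p q
  · linear_combination (norm := module) x • hP.compat₁ q p - x • hskew p q
  · linear_combination (norm := module) (y - x) • hcompat' p q
  · linear_combination (norm := module) -x • hP.compat₂ p q
  · linear_combination (norm := module) (z - x) • hP.compat₁ p q - z • hskew p q

end Bialgebra

/-! ### Threefold products of completed tensors -/

section Families

variable {k : Type u} [Field k]
variable {A : ℤ → Type v} [∀ i, AddCommGroup (A i)] [∀ i, Module k (A i)]
variable {V W U : Type*} [AddCommGroup V] [Module k V] [AddCommGroup W] [Module k W]
  [AddCommGroup U] [Module k U]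
variable {φ : (⨁ i, A i) →ₗ[k] V} {ψ : (⨁ i, A i) →ₗ[k] W} {χ : (⨁ i, A i) →ₗ[k] U}

section Prod

variable {X Y X' Y' Z X₁ X₁' : Type*}
  [AddCommGroup X] [Module k X] [AddCommGroup Y] [Module k Y]
  [AddCommGroup X'] [Module k X'] [AddCommGroup Y'] [Module k Y']
  [AddCommGroup Z] [Module k Z]
  [AddCommGroup X₁] [Module k X₁] [AddCommGroup X₁'] [Module k X₁']

/-- `prod1213 m` as a bilinear map. -/
def prodBilin (m : X →ₗ[k] X' →ₗ[k] Z) : X ⊗[k] Y →ₗ[k] X' ⊗[k] Y' →ₗ[k] Z ⊗[k] (Y ⊗[k] Y') :=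
  TensorProduct.curry (TensorProduct.map (TensorProduct.lift m) LinearMap.id ∘ₗ
    (TensorProduct.tensorTensorTensorComm k X Y X' Y').toLinearMap)

theorem prod1213_eq (m : X →ₗ[k] X' →ₗ[k] Z) (r : X ⊗[k] Y) (s : X' ⊗[k] Y') :
    prod1213 m r s = prodBilin m r s := rfl

/-- Two families of values that are linear in both tensors agree if they agree on pure tensors. -/
theorem bilin_ext_tmul {M : Type*} [AddCommGroup M] [Module k M]
    {f g : X ⊗[k] Y →ₗ[k] X' ⊗[k] Y' →ₗ[k] M}
    (h : ∀ x y x' y', f (x ⊗ₜ y) (x' ⊗ₜ y') = g (x ⊗ₜ y) (x' ⊗ₜ y')) : f = g :=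
  TensorProduct.ext' fun x y => TensorProduct.ext' fun x' y' => h x y x' y'

theorem prod1213_rTensor (m : X →ₗ[k] X' →ₗ[k] Z) (n : X₁ →ₗ[k] X₁' →ₗ[k] Z) (κ : k)
    (f : X₁ →ₗ[k] X) (f' : X₁' →ₗ[k] X') (h : ∀ x x', m (f x) (f' x') = κ • n x x')
    (r : X₁ ⊗[k] Y) (s : X₁' ⊗[k] Y') :
    prod1213 m (LinearMap.rTensor Y f r) (LinearMap.rTensor Y' f' s) = κ • prod1213 n r s := by
  have : (prodBilin (Y := Y) (Y' := Y') m).compl₁₂ (LinearMap.rTensor Y f)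
      (LinearMap.rTensor Y' f') = κ • prodBilin (Y := Y) (Y' := Y') n :=
    bilin_ext_tmul fun x y x' y' => by
      change m (f x) (f' x') ⊗ₜ[k] (y ⊗ₜ[k] y') = κ • n x x' ⊗ₜ[k] (y ⊗ₜ[k] y')
      rw [h, TensorProduct.smul_tmul']
  exact LinearMap.congr_fun₂ this r s

theorem prod1223_eq (m : Y →ₗ[k] X' →ₗ[k] Z) (r : X ⊗[k] Y) (s : X' ⊗[k] Y') :
    prod1223 m r s =
      TensorProduct.leftComm k Z X Y' (prod1213 m (TensorProduct.comm k X Y r) s) := by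
  induction r using TensorProduct.induction_on with
  | zero => simp [prod1223, prod1213]
  | add x y hx hy =>
    rw [map_add, prod1213_eq, map_add, LinearMap.add_apply, map_add, ← prod1213_eq, ← prod1213_eq,
      ← hx, ← hy]
    simp only [prod1223, TensorProduct.add_tmul, map_add]
  | tmul x y =>
    induction s using TensorProduct.induction_on with
    | zero => simp [prod1223, prod1213]
    | add z w hz hw =>
      rw [prod1213_eq, map_add, map_add, ← prod1213_eq, ← prod1213_eq, ← hz, ← hw]
      simp only [prod1223, TensorProduct.tmul_add, map_add]
    | tmul z w => rfl

theorem prod1323_eq (m : Y →ₗ[k] Y' →ₗ[k] Z) (r : X ⊗[k] Y) (s : X' ⊗[k] Y') :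
    prod1323 m r s = rotate k Z X X'
      (prod1213 m (TensorProduct.comm k X Y r) (TensorProduct.comm k X' Y' s)) := by
  induction r using TensorProduct.induction_on with
  | zero => simp [prod1323, prod1213]
  | add x y hx hy =>
    rw [map_add, prod1213_eq, map_add, LinearMap.add_apply, map_add, ← prod1213_eq, ← prod1213_eq,
      ← hx, ← hy]
    simp only [prod1323, TensorProduct.add_tmul, map_add]
  | tmul x y =>
    induction s using TensorProduct.induction_on with
    | zero => simp [prod1323, prod1213]
    | add z w hz hw =>
      rw [map_add, prod1213_eq, map_add, map_add, ← prod1213_eq, ← prod1213_eq, ← hz, ← hw]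
      simp only [prod1323, TensorProduct.tmul_add, map_add]
    | tmul z w => rfl

end Prod

/-- The family with formal sum `∑ m x_i x'_j ⊗ y_i ⊗ y'_j` for two completed tensors. -/
def familyProd (m : Op k (⨁ i, A i)) (r r' : CTwo k A) (s : ℤ × ℤ) : CThree k A :=
  fun a b c => prod1213 (blockOp m a s.1 s.2) (r s.1 b) (r' s.2 c)

/-- For each degree of the second factor only finitely many degrees of the first occur. -/
def FinLeft (r : CTwo k A) : Prop :=
  ∀ b, ∃ Q : Finset ℤ, ∀ i ∉ Q, r i b = 0

/-- `ρ ∈ A ⊗ W` is the contraction `(id ⊗̂ ψ)(r)`. -/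
def IsSlice (r : CTwo k A) (ψ : (⨁ i, A i) →ₗ[k] W) (ρ : (⨁ i, A i) ⊗[k] W) : Prop :=
  ∀ i, contrTwo (proj k A i) ψ r = LinearMap.rTensor W (proj k A i) ρ

theorem FinLeft.exists_finset {r : CTwo k A} (hr : FinLeft r) (T : Finset ℤ) :
    ∃ Q : Finset ℤ, ∀ b ∈ T, ∀ i ∉ Q, r i b = 0 := by
  classical
  choose Q hQ using hr
  exact ⟨T.biUnion Q, fun b hb i hi => hQ b i fun h => hi (Finset.mem_biUnion.2 ⟨b, hb, h⟩)⟩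

theorem familyProd_eq_zero (m : Op k (⨁ i, A i)) {r r' : CTwo k A} {Q Q' : Finset ℤ} {a b c : ℤ}
    (hQ : ∀ i ∉ Q, r i b = 0) (hQ' : ∀ i ∉ Q', r' i c = 0) {s : ℤ × ℤ} (hs : s ∉ Q ×ˢ Q') :
    familyProd m r r' s a b c = 0 := by
  rw [Finset.mem_product, not_and_or] at hs
  rw [familyProd, prod1213_eq]
  rcases hs with h | h
  · rw [hQ _ h, map_zero, LinearMap.zero_apply]
  · rw [hQ' _ h, map_zero]

theorem summable_familyProd (m : Op k (⨁ i, A i)) {r r' : CTwo k A} (hr : FinLeft r)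
    (hr' : FinLeft r') : Summable3 (familyProd m r r') := by
  intro a b c
  obtain ⟨Q, hQ⟩ := hr b
  obtain ⟨Q', hQ'⟩ := hr' c
  refine (Q ×ˢ Q').finite_toSet.subset fun s hs => ?_
  by_contra hne
  exact hs (familyProd_eq_zero m hQ hQ' hne)

/-- An element of `A ⊗ W` involves finitely many degrees. -/
theorem exists_finset_tensor (ρ : (⨁ i, A i) ⊗[k] W) : ∃ S : Finset ℤ, ∀ S' : Finset ℤ, S ⊆ S' →
    ρ = ∑ i ∈ S', LinearMap.rTensor W (inc k A i ∘ₗ proj k A i) ρ := by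
  classical
  induction ρ using TensorProduct.induction_on with
  | zero => exact ⟨∅, fun _ _ => by simp⟩
  | add x y hx hy =>
    obtain ⟨S, hS⟩ := hx
    obtain ⟨T, hT⟩ := hy
    refine ⟨S ∪ T, fun S' h => ?_⟩
    simp only [map_add, Finset.sum_add_distrib]
    rw [← hS S' (Finset.union_subset_left h), ← hT S' (Finset.union_subset_right h)]
  | tmul x w =>
    refine ⟨DFinsupp.support x, fun S' h => ?_⟩
    simp only [LinearMap.rTensor_tmul]
    rw [← TensorProduct.sum_tmul]
    congr 1
    conv_lhs => rw [← DirectSum.sum_support_of x]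
    refine Finset.sum_subset h fun i _ hi => ?_
    rw [DFinsupp.notMem_support_iff] at hi
    rw [hi, map_zero]

theorem sum_rotate {M ι κ l : Type*} [AddCommMonoid M] (s : Finset ι) (t : Finset κ)
    (u : Finset l) (f : ι → κ → l → M) :
    ∑ i ∈ s, ∑ j ∈ t, ∑ a ∈ u, f i j a = ∑ a ∈ u, ∑ i ∈ s, ∑ j ∈ t, f i j a := by
  rw [Finset.sum_congr rfl fun i _ => Finset.sum_comm, Finset.sum_comm]

/-- The contraction of a threefold product is the product of the slices. -/
theorem contrThree_familyProd (m : Op k (⨁ i, A i)) {r r' : CTwo k A} (hr : FinLeft r)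
    (hr' : FinLeft r') (hφ : FinSupp φ) (hψ : FinSupp ψ) (hχ : FinSupp χ)
    {ρ : (⨁ i, A i) ⊗[k] W} {ρ' : (⨁ i, A i) ⊗[k] U} (hρ : IsSlice r ψ ρ) (hρ' : IsSlice r' χ ρ') :
    contrThree φ ψ χ (formalSum (familyProd m r r')) = prod1213 (m.compr₂ φ) ρ ρ' := by
  classical
  obtain ⟨S, hS⟩ := hφ
  obtain ⟨T, hT⟩ := hψ
  obtain ⟨R, hR⟩ := hχ
  obtain ⟨Q₀, hQ₀⟩ := hr.exists_finset T
  obtain ⟨Q₀', hQ₀'⟩ := hr'.exists_finset R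
  obtain ⟨Q₁, hQ₁⟩ := exists_finset_tensor ρ
  obtain ⟨Q₁', hQ₁'⟩ := exists_finset_tensor ρ'
  obtain ⟨Q, hQ, hρQ⟩ : ∃ Q : Finset ℤ, (∀ b ∈ T, ∀ i ∉ Q, r i b = 0) ∧
      ρ = ∑ i ∈ Q, LinearMap.rTensor W (inc k A i ∘ₗ proj k A i) ρ :=
    ⟨Q₀ ∪ Q₁, fun b hb i hi => hQ₀ b hb i fun h => hi (Finset.mem_union_left _ h),
      hQ₁ _ Finset.subset_union_right⟩
  obtain ⟨Q', hQ', hρQ'⟩ : ∃ Q : Finset ℤ, (∀ b ∈ R, ∀ i ∉ Q, r' i b = 0) ∧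
      ρ' = ∑ i ∈ Q, LinearMap.rTensor U (inc k A i ∘ₗ proj k A i) ρ' :=
    ⟨Q₀' ∪ Q₁', fun b hb i hi => hQ₀' b hb i fun h => hi (Finset.mem_union_left _ h),
      hQ₁' _ Finset.subset_union_right⟩
  have hfin : ∀ a, ∀ b ∈ T, ∀ c ∈ R, formalSum (familyProd m r r') a b c =
      ∑ i ∈ Q, ∑ j ∈ Q', prod1213 (blockOp m a i j) (r i b) (r' j c) := by
    intro a b hb c hc
    rw [formalSum, finsum_eq_sum_of_support_subset (s := Q ×ˢ Q'), Finset.sum_product]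
    · rfl
    · intro s hs
      by_contra hne
      exact hs (familyProd_eq_zero m (hQ b hb) (hQ' c hc) hne)
  have hslice : ∀ i, LinearMap.rTensor W (proj k A i) ρ =
      ∑ b ∈ T, LinearMap.lTensor (A i) (ψ ∘ₗ inc k A b) (r i b) := by
    intro i
    rw [← hρ i, contrTwo_apply (S := {i}) (fun j hj =>
      proj_comp_inc_ne (by simpa using hj)) hT, Finset.sum_singleton]
    refine Finset.sum_congr rfl fun b _ => ?_
    rw [proj_comp_inc_self]
    rfl
  have hslice' : ∀ i, LinearMap.rTensor U (proj k A i) ρ' =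
      ∑ b ∈ R, LinearMap.lTensor (A i) (χ ∘ₗ inc k A b) (r' i b) := by
    intro i
    rw [← hρ' i, contrTwo_apply (S := {i}) (fun j hj =>
      proj_comp_inc_ne (by simpa using hj)) hR, Finset.sum_singleton]
    refine Finset.sum_congr rfl fun b _ => ?_
    rw [proj_comp_inc_self]
    rfl
  have hterm : ∀ i j b c, prod1213 ((m.compl₁₂ (inc k A i) (inc k A j)).compr₂ φ)
      (LinearMap.lTensor (A i) (ψ ∘ₗ inc k A b) (r i b))
      (LinearMap.lTensor (A j) (χ ∘ₗ inc k A c) (r' j c)) =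
      ∑ a ∈ S, TensorProduct.map (φ ∘ₗ inc k A a)
        (TensorProduct.map (ψ ∘ₗ inc k A b) (χ ∘ₗ inc k A c))
          (prod1213 (blockOp m a i j) (r i b) (r' j c)) := by
    intro i j b c
    have h : (prodBilin ((m.compl₁₂ (inc k A i) (inc k A j)).compr₂ φ)).compl₁₂
        (LinearMap.lTensor (A i) (ψ ∘ₗ inc k A b)) (LinearMap.lTensor (A j) (χ ∘ₗ inc k A c)) =
        ∑ a ∈ S, (prodBilin (blockOp m a i j)).compr₂ (TensorProduct.map (φ ∘ₗ inc k A a)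
          (TensorProduct.map (ψ ∘ₗ inc k A b) (χ ∘ₗ inc k A c))) :=
      bilin_ext_tmul fun x y x' y' => by
        simp only [LinearMap.sum_apply]
        change φ (m (inc k A i x) (inc k A j x')) ⊗ₜ (ψ (inc k A b y) ⊗ₜ χ (inc k A c y')) =
          ∑ a ∈ S, φ (inc k A a (proj k A a (m (inc k A i x) (inc k A j x')))) ⊗ₜ
            (ψ (inc k A b y) ⊗ₜ χ (inc k A c y'))
        rw [← TensorProduct.sum_tmul]
        conv_lhs => rw [eq_sum_of_finSupp hS, LinearMap.sum_apply]
        rfl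
    have h' := LinearMap.congr_fun₂ h (r i b) (r' j c)
    simp only [LinearMap.sum_apply] at h'
    exact h'
  have hmain : prod1213 (m.compr₂ φ) ρ ρ' = ∑ i ∈ Q, ∑ j ∈ Q', ∑ b ∈ T, ∑ c ∈ R,
      prod1213 ((m.compl₁₂ (inc k A i) (inc k A j)).compr₂ φ)
        (LinearMap.lTensor (A i) (ψ ∘ₗ inc k A b) (r i b))
        (LinearMap.lTensor (A j) (χ ∘ₗ inc k A c) (r' j c)) := by
    rw [prod1213_eq]
    conv_lhs => rw [hρQ, hρQ']
    rw [LinearMap.map_sum₂]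
    refine Finset.sum_congr rfl fun i _ => ?_
    rw [map_sum]
    refine Finset.sum_congr rfl fun j _ => ?_
    rw [LinearMap.rTensor_comp_apply, LinearMap.rTensor_comp_apply, hslice, hslice']
    simp only [prod1213_eq]
    have h : (prodBilin (m.compr₂ φ)).compl₁₂ (LinearMap.rTensor W (inc k A i))
        (LinearMap.rTensor U (inc k A j)) =
        prodBilin ((m.compl₁₂ (inc k A i) (inc k A j)).compr₂ φ) :=
      bilin_ext_tmul fun x y x' y' => rfl
    refine (LinearMap.congr_fun₂ h _ _).trans ?_
    rw [LinearMap.map_sum₂]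
    refine Finset.sum_congr rfl fun b _ => ?_
    rw [map_sum]
  rw [hmain, contrThree_apply hS hT hR]
  simp only [hterm]
  rw [Finset.sum_congr rfl fun a _ => Finset.sum_congr rfl fun b hb =>
    Finset.sum_congr rfl fun c hc => by rw [hfin a b hb c hc, map_sum,
      Finset.sum_congr rfl fun i _ => map_sum _ _ _]]
  symm
  rw [Finset.sum_congr rfl fun i _ => Finset.sum_congr rfl fun j _ => sum_rotate T R S _,
    sum_rotate Q Q' S]
  refine Finset.sum_congr rfl fun a _ => ?_
  rw [sum_rotate Q Q' T]
  refine Finset.sum_congr rfl fun b _ => ?_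
  rw [sum_rotate Q Q' R]

/-- `Y ↦ ∑ y ⊗ z ⊗ x` for `Y = ∑ x ⊗ y ⊗ z` in the completed tensor cube. -/
def hatRotate (Y : CThree k A) : CThree k A :=
  fun a b c => rotate k (A c) (A a) (A b) (Y c a b)

theorem contrThree_hatRotate (hφ : FinSupp φ) (hψ : FinSupp ψ) (hχ : FinSupp χ)
    (Y : CThree k A) :
    contrThree φ ψ χ (hatRotate Y) = rotate k U V W (contrThree χ φ ψ Y) := by
  obtain ⟨S, hS⟩ := hφ
  obtain ⟨T, hT⟩ := hψ
  obtain ⟨R, hR⟩ := hχ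
  rw [contrThree_apply hS hT hR, contrThree_apply hR hS hT, sum_rotate]
  simp only [map_sum]
  refine Finset.sum_congr rfl fun c _ => Finset.sum_congr rfl fun a _ =>
    Finset.sum_congr rfl fun b _ => ?_
  rw [hatRotate]
  induction Y c a b using TensorProduct.induction_on with
  | zero => simp
  | add x y hx hy => simp only [map_add, hx, hy]
  | tmul x y =>
    induction y using TensorProduct.induction_on with
    | zero => simp
    | add y z hy hz => simp only [TensorProduct.tmul_add, map_add, hy, hz]
    | tmul y z => rfl

theorem family1223_eq (m : Op k (⨁ i, A i)) (r : CTwo k A) (s : ℤ × ℤ) :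
    family1223 m r s = hatTau12 (familyProd m (hatTau r) r s) := by
  funext a b c
  exact prod1223_eq _ _ _

theorem family1323_eq (m : Op k (⨁ i, A i)) (r : CTwo k A) (s : ℤ × ℤ) :
    family1323 m r s = hatRotate (familyProd m (hatTau r) (hatTau r) s) := by
  funext a b c
  exact prod1323_eq _ _ _

theorem Summable3.hatTau12 {ι : Type*} {F : ι → CThree k A} (hF : Summable3 F) :
    Summable3 fun s => hatTau12 (F s) := fun a b c =>
  (hF b a c).subset fun _ hs h => hs (by simp only [DPP.hatTau12, h, map_zero])

theorem Summable3.hatRotate {ι : Type*} {F : ι → CThree k A} (hF : Summable3 F) :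
    Summable3 fun s => hatRotate (F s) := fun a b c =>
  (hF c a b).subset fun _ hs h => hs (by simp only [DPP.hatRotate, h, map_zero])

theorem formalSum_hatTau12 {ι : Type*} (F : ι → CThree k A) :
    formalSum (fun s => hatTau12 (F s)) = hatTau12 (formalSum F) := by
  funext a b c
  exact (AddEquiv.map_finsum (TensorProduct.leftComm k (A b) (A a) (A c)).toAddEquiv _).symm

theorem formalSum_hatRotate {ι : Type*} (F : ι → CThree k A) :
    formalSum (fun s => hatRotate (F s)) = hatRotate (formalSum F) := by
  funext a b c
  exact (AddEquiv.map_finsum (rotate k (A c) (A a) (A b)).toAddEquiv _).symm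

end Families

/-! ### The tensor `r̂` -/

section Coboundary

variable {k : Type u} [Field k]
variable {P : Type w} [AddCommGroup P] [Module k P]
variable {B : ℤ → Type v} [∀ i, AddCommGroup (B i)] [∀ i, Module k (B i)]
variable {circB : Op k (⨁ i, B i)} {ω : (⨁ i, B i) →ₗ[k] (⨁ i, B i) →ₗ[k] k}

section Casimir

variable {Ω : Type*} {e : Module.Basis Ω k (⨁ i, B i)} {f : Ω → ⨁ i, B i}

theorem finite_homogeneous_basis (hB : IsQuadraticPerm circB ω)
    (h : IsDualHomogeneousPair ω e f) (i : ℤ) : {l | proj k B i (e l) ≠ 0}.Finite := by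
  have := hB.alg.finite i
  have hinc : ∀ l : {l | proj k B i (e l) ≠ 0}, inc k B i (proj k B i (e l)) = e l := by
    rintro ⟨l, hl⟩
    obtain ⟨j, x, hx⟩ := h.homogeneous l
    rw [Set.mem_ofPred_eq, hx] at hl
    by_cases hj : j = i
    · subst hj
      rw [hx, proj_inc_self]
    · exact absurd (proj_inc_ne hj x) hl
  have hli : LinearIndependent k fun l : {l | proj k B i (e l) ≠ 0} => proj k B i (e l) := by
    refine LinearIndependent.of_comp (inc k B i) ?_
    have : (inc k B i ∘ fun l : {l | proj k B i (e l) ≠ 0} => proj k B i (e l)) =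
        fun l : {l | proj k B i (e l) ≠ 0} => e l := funext hinc
    rw [this]
    exact e.linearIndependent.comp _ Subtype.val_injective
  exact Set.finite_coe_iff.1 hli.finite

theorem omega_dual_eq_repr (h : IsDualHomogeneousPair ω e f) (l : Ω) (t : ⨁ i, B i) :
    ω (f l) t = e.repr t l := by
  have : ω (f l) = e.coord l := e.ext fun l' => by
    by_cases hl : l = l'
    · subst hl
      rw [h.dual_self, Module.Basis.coord_apply, Module.Basis.repr_self, Finsupp.single_eq_same]
    · rw [h.dual_ne l l' hl, Module.Basis.coord_apply, Module.Basis.repr_self,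
        Finsupp.single_eq_of_ne hl]
  rw [this, Module.Basis.coord_apply]

/-- The tensor `∑ e_j ⊗ f_j` represents the form `(s, t) ↦ ω(t, s)`. -/
theorem omegaHat_casimir (hB : IsQuadraticPerm circB ω) (h : IsDualHomogeneousPair ω e f)
    (s t : ⨁ i, B i) : omegaHat ω (casimir e f) s t = ω t s := by
  classical
  have hfin : ∀ u, ∃ S : Finset ℤ, ∀ i ∉ S, ω.flip u ∘ₗ inc k B i = 0 := by
    intro u
    obtain ⟨S, hS⟩ := finSupp_pairAt (P := k) hB u
    refine ⟨S, fun i hi => LinearMap.ext fun x => ?_⟩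
    have h1 := LinearMap.congr_fun (hS i hi) (1 ⊗ₜ x)
    rw [LinearMap.comp_apply, inc_tmul, pairAt_tmul, LinearMap.zero_apply, smul_eq_mul,
      mul_one] at h1
    exact h1
  obtain ⟨S, hS⟩ := hfin s
  obtain ⟨T, hT⟩ := hfin t
  let Q : Finset Ω := S.biUnion fun i => (finite_homogeneous_basis hB h i).toFinset
  have hQ : ∀ i ∈ S, ∀ l ∉ Q, proj k B i (e l) = 0 := fun i hi l hl => by
    by_contra hne
    exact hl (Finset.mem_biUnion.2 ⟨i, hi, (Set.Finite.mem_toFinset _).2 hne⟩)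
  have hcas : ∀ i ∈ S, ∀ j, casimir e f i j =
      ∑ l ∈ Q, proj k B i (e l) ⊗ₜ[k] proj k B j (f l) := fun i hi j => by
    refine finsum_eq_sum_of_support_subset _ fun l hl => ?_
    by_contra hne
    exact hl (by beta_reduce; rw [hQ i hi l hne, TensorProduct.zero_tmul])
  have hs : ∀ b, ω b s = ∑ i ∈ S, ω (inc k B i (proj k B i b)) s := fun b => by
    have := LinearMap.congr_fun (eq_sum_of_finSupp hS) b
    rwa [LinearMap.sum_apply] at this
  have ht : ∀ b, ω b t = ∑ i ∈ T, ω (inc k B i (proj k B i b)) t := fun b => by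
    have := LinearMap.congr_fun (eq_sum_of_finSupp hT) b
    rwa [LinearMap.sum_apply] at this
  have hsum : omegaHat ω (casimir e f) s t = ∑ l ∈ Q, ω (e l) s * ω (f l) t := by
    rw [omegaHat, finsum_eq_sum_of_support_subset (s := S ×ˢ T), Finset.sum_product,
      Finset.sum_congr rfl fun i hi => Finset.sum_congr rfl fun j _ => by
        rw [hcas i hi j, map_sum]]
    · rw [Finset.sum_congr rfl fun i _ => Finset.sum_comm, Finset.sum_comm]
      refine Finset.sum_congr rfl fun l _ => ?_
      rw [hs (e l), ht (f l), Finset.sum_mul_sum]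
      rfl
    · intro ij hij
      rw [Finset.coe_product]
      by_contra hne
      refine hij ?_
      rw [Set.mem_prod, not_and_or] at hne
      beta_reduce
      rw [pairBlock]
      rcases hne with h' | h'
      · rw [hS _ h', TensorProduct.map_zero_left, LinearMap.comp_zero, LinearMap.zero_apply]
      · rw [hT _ h', TensorProduct.map_zero_right, LinearMap.comp_zero, LinearMap.zero_apply]
  rw [hsum]
  conv_rhs => rw [← e.linearCombination_repr t, Finsupp.linearCombination_apply, Finsupp.sum,
    map_sum, LinearMap.sum_apply]
  simp only [omega_dual_eq_repr h, map_smul, LinearMap.smul_apply, smul_eq_mul, mul_comm (ω _ s)]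
  rw [Finset.sum_subset (Finset.subset_union_left (s₂ := (e.repr t).support)),
    Finset.sum_subset (Finset.subset_union_right (s₁ := Q) (s₂ := (e.repr t).support))]
  · intro l _ hl
    rw [Finsupp.notMem_support_iff.1 hl, zero_mul]
  · intro l _ hl
    rw [hs, Finset.sum_eq_zero fun i hi => by rw [hQ i hi l hl, map_zero, map_zero,
      LinearMap.zero_apply], mul_zero]

theorem pairTwo_rHat (hB : IsQuadraticPerm circB ω) (h : IsDualHomogeneousPair ω e f)
    (r : P ⊗[k] P) (s t : ⨁ i, B i) : pairTwo ω s t (rHat e f r) = ω t s • r := by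
  rw [rHat, pairTwo_bullet hB, omegaHat_casimir hB h]

variable (hB : IsQuadraticPerm circB ω) (h : IsDualHomogeneousPair ω e f)
include hB h

/-- The form is skew, so the twist of `r̂` is the tensor associated with `-τ(r)`. -/
theorem hatTau_rHat (r : P ⊗[k] P) : hatTau (rHat e f r) = rHat e f (-tau k P r) :=
  pairTwo_ext hB fun s t => by
    rw [pairTwo_hatTau hB, pairTwo_rHat hB h, pairTwo_rHat hB h, map_smul, hB.skew t s, smul_neg,
      neg_smul, neg_neg]

theorem rHat_sub_hatTau (r : P ⊗[k] P) :
    rHat e f r - hatTau (rHat e f r) = rHat e f (r + tau k P r) := by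
  rw [hatTau_rHat hB h, rHat, rHat, rHat, map_neg, map_add, LinearMap.neg_apply,
    LinearMap.add_apply, sub_neg_eq_add]

/-! ### The coboundary formulas -/

theorem indCo_eq_cobNu {mul : Op k P} (hmul : mul.flip = mul) {D : P →ₗ[k] P ⊗[k] P}
    {r : P ⊗[k] P} (hD : ∀ p, D p = cobDelta mul r p) (a : ⨁ i, PB k P B i) :
    indCo D (nuOmega hB) a = cobNu (indOp mul circB) (rHat e f r) a := by
  have := locFin_indOp hB mul
  induction a using induction_tmul with
  | zero => simp only [cobNu, map_zero, sub_zero, hatL_zero_left, hatR_zero_left, add_zero]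
  | add a b ha hb =>
    rw [map_add, ha, hb]
    simp only [cobNu, map_add, hatL_sub_left, hatL_add_left, hatR_add_left]
    abel
  | tmul p b =>
    refine pairTwo_ext hB fun s t => ?_
    rw [pairTwo_indCo, cobNu, hatL_sub_left, map_add, map_sub, pairTwo_hatR_right hB,
      pairTwo_hatL_right hB, pairTwo_hatL_left hB, pairTwo_rHat hB h, pairTwo_rHat hB h,
      pairTwo_rHat hB h, hmul, omega_commutator hB, map_sub (ω t), omega_mul_right hB, hD, cobDelta]
    simp only [map_smul]
    module

theorem indCo_eq_cobTheta {br : Op k P} (hbr : br.flip = -br) {D : P →ₗ[k] P ⊗[k] P}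
    {r : P ⊗[k] P} (hD : ∀ p, D p = cobdelta br r p) (a : ⨁ i, PB k P B i) :
    indCo D (nuOmega hB) a = cobTheta (indOp br circB) (rHat e f r) a := by
  have := locFin_indOp hB br
  induction a using induction_tmul with
  | zero => simp only [cobTheta, map_zero, add_zero, hatL_zero_left, hatR_zero_left, sub_zero]
  | add a b ha hb =>
    rw [map_add, ha, hb]
    simp only [cobTheta, map_add, hatL_add_left, hatR_add_left]
    abel
  | tmul p b =>
    refine pairTwo_ext hB fun s t => ?_
    rw [pairTwo_indCo, cobTheta, hatL_add_left, map_sub, map_add, pairTwo_hatR_right hB,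
      pairTwo_hatL_right hB, pairTwo_hatL_left hB, pairTwo_rHat hB h, pairTwo_rHat hB h,
      pairTwo_rHat hB h, hbr, omega_commutator hB, map_sub (ω t), omega_mul_right hB, hD, cobdelta]
    simp only [map_smul, LinearMap.neg_apply, LinearMap.lTensor_neg, LinearMap.rTensor_neg]
    module

theorem isDPInvariant_rHat {mul br : Op k P} (hmul : mul.flip = mul) (hbr : br.flip = -br)
    {r : P ⊗[k] P} (hr : IsPoiInvariant mul br r) :
    IsDPInvariant (indOp mul circB) (indOp br circB) (rHat e f r) := by
  have h0 : ∀ a, indCo (0 : P →ₗ[k] P ⊗[k] P) (nuOmega hB) a = 0 := fun a => by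
    induction a using induction_tmul with
    | zero => rw [map_zero]
    | add a b ha hb => rw [map_add, ha, hb, add_zero]
    | tmul p b => rw [indCo_tmul, LinearMap.zero_apply, map_zero, LinearMap.zero_apply]
  intro a
  rw [← indCo_eq_cobTheta hB h hbr (D := 0) fun p => (hr p).2.symm,
    ← indCo_eq_cobNu hB h hmul (D := 0) fun p => (hr p).1.symm, h0]
  exact ⟨rfl, rfl⟩

/-! ### The Yang-Baxter equation -/

omit hB h in
/-- The inclusion `p ↦ p ⊗ t`. -/
def insertAt (k : Type u) [Field k] (P : Type w) [AddCommGroup P] [Module k P]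
    {B : ℤ → Type v} [∀ i, AddCommGroup (B i)] [∀ i, Module k (B i)] (t : ⨁ i, B i) :
    P →ₗ[k] ⨁ i, PB k P B i :=
  (distrib k P B).toLinearMap ∘ₗ (TensorProduct.mk k P (⨁ i, B i)).flip t

/-- Contracting the second factor of `∑ e_j ⊗ f_j` with `t` gives back `t`. -/
theorem isSlice_rHat (r : P ⊗[k] P) (t : ⨁ i, B i) :
    IsSlice (rHat e f r) (pairAt ω t) (LinearMap.rTensor P (insertAt k P t) r) := by
  intro i
  obtain ⟨n, x, s, -, hx, hi⟩ := exists_proj_eq_sum_pairAt (P := P) hB i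
  have hfs := fun u => finSupp_pairAt (P := P) hB u
  have hins : proj k (PB k P B) i ∘ₗ insertAt k P t =
      ∑ l, ω t (s l) • (TensorProduct.mk k P (B i)).flip (x l) := LinearMap.ext fun p => by
    rw [LinearMap.comp_apply, insertAt, LinearMap.comp_apply, LinearEquiv.coe_coe]
    change proj k (PB k P B) i (distrib k P B (p ⊗ₜ t)) = _
    rw [proj_distrib, hx, LinearMap.sum_apply, TensorProduct.tmul_sum]
    exact Finset.sum_congr rfl fun l _ => TensorProduct.tmul_smul _ _ _
  rw [← LinearMap.rTensor_comp_apply, hins, hi,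
    contrTwo_sum_left _ (fun l _ => (hfs _).comp _) (hfs _)]
  refine Eq.trans ?_ (map_sum_left _ _ LinearMap.id r).symm
  refine Finset.sum_congr rfl fun l _ => ?_
  have h1 := contrTwo_comp (hfs (s l)) (hfs t) ((TensorProduct.mk k P (B i)).flip (x l))
    LinearMap.id (rHat e f r)
  rw [LinearMap.id_comp] at h1
  have h2 := pairTwo_rHat (P := P) hB h r (s l) t
  rw [pairTwo] at h2
  rw [h1, h2, map_smul, TensorProduct.map_smul_left, LinearMap.smul_apply]

theorem finLeft_rHat (r : P ⊗[k] P) : FinLeft (rHat e f r) := by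
  classical
  intro j
  obtain ⟨n, y, t, -, -, hy⟩ := exists_proj_eq_sum_pairAt (P := P) hB j
  have hfs := fun u => finSupp_pairAt (P := P) hB u
  choose Q hQ using fun l : Fin n =>
    exists_finset_tensor (LinearMap.rTensor P (insertAt k P (t l)) r)
  have hQ' : ∀ l, ∀ i ∉ Q l, LinearMap.rTensor P (proj k (PB k P B) i)
      (LinearMap.rTensor P (insertAt k P (t l)) r) = 0 := by
    intro l i hi
    rw [hQ l (Q l) subset_rfl, map_sum]
    refine Finset.sum_eq_zero fun i' hi' => ?_
    rw [← LinearMap.rTensor_comp_apply]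
    have h0 : proj k (PB k P B) i ∘ₗ inc k (PB k P B) i' ∘ₗ proj k (PB k P B) i' = 0 :=
      LinearMap.ext fun x => proj_inc_ne (k := k) (fun hne : i' = i => hi (hne ▸ hi')) _
    rw [h0, LinearMap.rTensor_zero, LinearMap.zero_apply]
  refine ⟨Finset.univ.biUnion Q, fun i hi => ?_⟩
  rw [← contrTwo_proj i j (rHat e f r), hy,
    contrTwo_sum_right _ (finSupp_proj i) fun l _ => (hfs _).comp _]
  refine Finset.sum_eq_zero fun l _ => ?_
  have h1 := contrTwo_comp (finSupp_proj (k := k) (A := PB k P B) i) (hfs (t l)) LinearMap.id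
    ((TensorProduct.mk k P (B j)).flip (y l)) (rHat e f r)
  rw [LinearMap.id_comp] at h1
  rw [h1, isSlice_rHat hB h r (t l) i, hQ' l i fun hmem =>
    hi (Finset.mem_biUnion.2 ⟨l, Finset.mem_univ l, hmem⟩), map_zero]

theorem summable_family1213_rHat (N : Op k (⨁ i, PB k P B i)) (r : P ⊗[k] P) :
    Summable3 (family1213 N (rHat e f r)) :=
  summable_familyProd N (finLeft_rHat hB h r) (finLeft_rHat hB h r)

theorem summable_family1223_rHat (N : Op k (⨁ i, PB k P B i)) (r : P ⊗[k] P) :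
    Summable3 (family1223 N (rHat e f r)) := by
  have := (summable_familyProd N (finLeft_rHat hB h (-tau k P r)) (finLeft_rHat hB h r)).hatTau12
  rw [← hatTau_rHat hB h] at this
  exact (funext (family1223_eq N (rHat e f r))) ▸ this

theorem summable_family1323_rHat (N : Op k (⨁ i, PB k P B i)) (r : P ⊗[k] P) :
    Summable3 (family1323 N (rHat e f r)) := by
  have := (summable_familyProd N (finLeft_rHat hB h (-tau k P r))
    (finLeft_rHat hB h (-tau k P r))).hatRotate
  rw [← hatTau_rHat hB h] at this
  exact (funext (family1323_eq N (rHat e f r))) ▸ this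

variable {N : Op k (⨁ i, PB k P B i)} {n : Op k P} {s t u : ⨁ i, B i} {κ : k}

theorem pairThree_familyProd_rHat
    (hN : ∀ p q, pairAt ω s (N (insertAt k P t p) (insertAt k P u q)) = κ • n p q)
    (r r' : P ⊗[k] P) :
    pairThree ω s t u (formalSum (familyProd N (rHat e f r) (rHat e f r'))) =
      κ • prod1213 n r r' := by
  have hfs := fun u => finSupp_pairAt (P := P) hB u
  rw [pairThree, contrThree_familyProd N (finLeft_rHat hB h r) (finLeft_rHat hB h r') (hfs s)
    (hfs t) (hfs u) (isSlice_rHat hB h r t) (isSlice_rHat hB h r' u)]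
  exact prod1213_rTensor _ n κ _ _ hN r r'

theorem pairThree_family1213_rHat
    (hN : ∀ p q, pairAt ω s (N (insertAt k P t p) (insertAt k P u q)) = κ • n p q)
    (r : P ⊗[k] P) :
    pairThree ω s t u (formalSum (family1213 N (rHat e f r))) = κ • prod1213 n r r :=
  pairThree_familyProd_rHat hB h hN r r

theorem pairThree_family1223_rHat
    (hN : ∀ p q, pairAt ω t (N (insertAt k P s p) (insertAt k P u q)) = κ • n p q)
    (r : P ⊗[k] P) :
    pairThree ω s t u (formalSum (family1223 N (rHat e f r))) = -(κ • prod1223 n r r) := by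
  rw [funext (family1223_eq N (rHat e f r)), formalSum_hatTau12, pairThree_hatTau12 hB,
    hatTau_rHat hB h, pairThree_familyProd_rHat hB h hN, prod1223_eq, prod1213_eq, map_neg,
    LinearMap.neg_apply, smul_neg, map_neg, map_smul]
  rfl

theorem pairThree_family1323_rHat
    (hN : ∀ p q, pairAt ω u (N (insertAt k P s p) (insertAt k P t q)) = κ • n p q)
    (r : P ⊗[k] P) :
    pairThree ω s t u (formalSum (family1323 N (rHat e f r))) = κ • prod1323 n r r := by
  have hfs := fun u => finSupp_pairAt (P := P) hB u
  rw [funext (family1323_eq N (rHat e f r)), formalSum_hatRotate, pairThree,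
    contrThree_hatRotate (hfs s) (hfs t) (hfs u)]
  change rotate k P P P (pairThree ω u s t _) = _
  rw [hatTau_rHat hB h, pairThree_familyProd_rHat hB h hN, prod1323_eq, prod1213_eq, map_neg,
    map_neg, LinearMap.neg_apply, neg_neg, map_smul]
  rfl

omit hB h in
theorem pairAt_indOp_insertAt (m : Op k P) (s t u : ⨁ i, B i) (p q : P) :
    pairAt ω s (indOp m circB (insertAt k P t p) (insertAt k P u q)) =
      ω (circB t u) s • m p q := by
  refine Eq.trans ?_ (pairAt_tmul s (circB t u) (m p q))
  rw [← indOp_tmul]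
  rfl

/-- On `r̂` the three products carry the scalars `ω(t ∘ u, s)`, `-ω(s ∘ u, t)` and
`ω(s ∘ t, u)`; the invariance of `ω` turns the completed equations into scalar multiples of the
Poisson ones. -/
theorem isCompletedDPYBESolution_rHat {mul br : Op k P} (hmul : mul.flip = mul)
    (hbr : br.flip = -br) {r : P ⊗[k] P} (hr : IsPoiYBESolution mul br r) :
    IsCompletedDPYBESolution (indOp mul circB) (indOp br circB) (rHat e f r) where
  summable_circ := ⟨summable_family1223_rHat hB h _ r, summable_family1323_rHat hB h _ r,
    summable_family1213_rHat hB h _ r, summable_family1213_rHat hB h _ r⟩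
  summable_ast := ⟨summable_family1213_rHat hB h _ r, summable_family1223_rHat hB h _ r,
    summable_family1223_rHat hB h _ r, summable_family1323_rHat hB h _ r⟩
  permYBE := pairThree_ext hB fun s t u => by
    have hcomm : ∀ p q, mul q p = mul p q := fun p q => LinearMap.congr_fun₂ hmul p q
    have h3 : ω (circB u t) s = ω t (circB u s) := omega_mul_left hB u t s
    have h4 : ω (circB s t) u = -ω (circB s u) t := by
      rw [omega_mul_left hB, hB.skew]
    have h5 : ω (circB t u) s = ω t (circB u s) + ω (circB s u) t := by
      rw [hB.invariant, map_sub, hB.skew t (circB s u)]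
      ring
    have hy := hr.assocYBE
    rw [hmul] at hy
    rw [map_sub, map_add, map_sub, map_zero,
      pairThree_family1223_rHat hB h (pairAt_indOp_insertAt mul t s u),
      pairThree_family1323_rHat hB h (pairAt_indOp_insertAt mul u s t),
      pairThree_family1213_rHat hB h (pairAt_indOp_insertAt mul s t u),
      pairThree_family1213_rHat hB h (n := mul) (κ := ω (circB u t) s) fun p q => by
        rw [LinearMap.flip_apply, pairAt_indOp_insertAt, hcomm], h3, h4, h5]
    linear_combination (norm := module) ω (circB s u) t • hy
  leibYBE := pairThree_ext hB fun s t u => by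
    have hskew : ∀ p q, br q p = -br p q := fun p q => LinearMap.congr_fun₂ hbr p q
    have h1 : ω (circB t s) u = -ω (circB t u) s := by
      rw [omega_mul_left hB, hB.skew]
    have h2 : ω (circB s u) t = ω (circB u s) t + ω (circB t u) s := by
      rw [hB.invariant, map_sub, omega_mul_left hB u s, hB.skew s (circB t u)]
      ring
    rw [map_add, map_sub, map_sub, map_zero,
      pairThree_family1213_rHat hB h (pairAt_indOp_insertAt br s t u),
      pairThree_family1223_rHat hB h (pairAt_indOp_insertAt br t s u),
      pairThree_family1223_rHat hB h (n := br) (κ := -ω (circB u s) t) fun p q => by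
        rw [LinearMap.flip_apply, pairAt_indOp_insertAt, hskew, smul_neg, neg_smul],
      pairThree_family1323_rHat hB h (n := br) (κ := -ω (circB t s) u) fun p q => by
        rw [LinearMap.flip_apply, pairAt_indOp_insertAt, hskew, smul_neg, neg_smul], h1, h2]
    linear_combination (norm := module) ω (circB t u) s • hr.classicalYBE

end Casimir

/-- A quadratic graded perm algebra has a homogeneous basis with a dual basis. -/
theorem exists_isDualHomogeneousPair (hB : IsQuadraticPerm circB ω) :
    ∃ (Ω : Type) (e : Module.Basis Ω k (⨁ i, B i)) (f : Ω → ⨁ i, B i),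
      IsDualHomogeneousPair ω e f := by
  have := hB.alg.finite
  let x := fun i => Module.finBasis k (B i)
  let e : Module.Basis (Σ i, Fin (Module.finrank k (B i))) k (⨁ i, B i) := DFinsupp.basis x
  have he : ∀ w, e w = inc k B w.1 (x w.1 w.2) := fun w => by
    change (DFinsupp.basis x) w = _
    rw [Module.Basis.apply_eq_iff]
    ext w'
    change (x w'.1).repr (proj k B w'.1 (inc k B w.1 (x w.1 w.2))) w'.2 = _
    obtain ⟨i, l⟩ := w
    obtain ⟨i', l'⟩ := w'
    by_cases hi : i = i'
    · subst hi
      rw [proj_inc_self, Module.Basis.repr_self]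
      by_cases hl : l = l'
      · rw [hl, Finsupp.single_eq_same, Finsupp.single_eq_same]
      · have hne : (⟨i, l⟩ : Σ i, Fin (Module.finrank k (B i))) ≠ ⟨i, l'⟩ := fun h =>
          hl (by simpa using h)
        rw [Finsupp.single_eq_of_ne' hl, Finsupp.single_eq_of_ne' hne]
    · rw [proj_inc_ne hi, map_zero, Finsupp.zero_apply,
        Finsupp.single_eq_of_ne' fun h => hi (Sigma.mk.inj h).1]
  choose f hf using fun w : Σ i, Fin (Module.finrank k (B i)) =>
    exists_omega_eq hB w.1 (-(x w.1).coord w.2)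
  have hfe : ∀ w w', ω (f w) (e w') = (x w.1).coord w.2 (proj k B w.1 (e w')) := fun w w' => by
    rw [hB.skew, hf, LinearMap.neg_apply, neg_neg]
  refine ⟨_, e, f, fun w => ⟨w.1, x w.1 w.2, he w⟩, fun w => ?_, fun w w' hne => ?_⟩
  · rw [hfe, he, proj_inc_self, Module.Basis.coord_apply, Module.Basis.repr_self,
      Finsupp.single_eq_same]
  · obtain ⟨i, l⟩ := w
    obtain ⟨i', l'⟩ := w'
    rw [hfe, he]
    by_cases hi : i' = i
    · subst hi
      rw [proj_inc_self, Module.Basis.coord_apply, Module.Basis.repr_self,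
        Finsupp.single_eq_of_ne fun hl : l = l' => hne (by rw [hl])]
    · rw [proj_inc_ne hi, map_zero]

end Coboundary

/-! ### Coboundary, quasi-triangular and triangular structures -/

section Transfer

variable {k : Type u} [Field k]
variable {P : Type w} [AddCommGroup P] [Module k P] [FiniteDimensional k P]
variable {B : ℤ → Type v} [∀ i, AddCommGroup (B i)] [∀ i, Module k (B i)]
variable {circB : Op k (⨁ i, B i)} {ω : (⨁ i, B i) →ₗ[k] (⨁ i, B i) →ₗ[k] k}
variable {Ω : Type*} {e : Module.Basis Ω k (⨁ i, B i)} {f : Ω → ⨁ i, B i}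
variable {mul br : Op k P} {Δ δ : P →ₗ[k] P ⊗[k] P} {r : P ⊗[k] P}

theorem IsCoboundaryPoisson.isCoboundaryDPP (h : IsCoboundaryPoisson mul br Δ δ r)
    (hB : IsQuadraticPerm circB ω) (hef : IsDualHomogeneousPair ω e f) :
    IsCoboundaryDPP (indOp mul circB) (indOp br circB) (indCo Δ (nuOmega hB))
      (indCo δ (nuOmega hB)) (rHat e f r) where
  bialg := isCompletedDPPBialgebra_ind h.bialg hB
  nu_eq := indCo_eq_cobNu hB hef h.bialg.alg.mul_flip h.Delta_eq
  theta_eq := indCo_eq_cobTheta hB hef h.bialg.alg.br_flip h.delta_eq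

theorem IsQuasiTriangularPoisson.isQuasiTriangularDPP (h : IsQuasiTriangularPoisson mul br Δ δ r)
    (hB : IsQuadraticPerm circB ω) (hef : IsDualHomogeneousPair ω e f) :
    IsQuasiTriangularDPP (indOp mul circB) (indOp br circB) (indCo Δ (nuOmega hB))
      (indCo δ (nuOmega hB)) (rHat e f r) where
  toIsCoboundaryDPP := h.toIsCoboundaryPoisson.isCoboundaryDPP hB hef
  ybe := isCompletedDPYBESolution_rHat hB hef h.bialg.alg.mul_flip h.bialg.alg.br_flip h.ybe
  invariant := by
    rw [rHat_sub_hatTau hB hef]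
    exact isDPInvariant_rHat hB hef h.bialg.alg.mul_flip h.bialg.alg.br_flip h.invariant

theorem IsTriangularPoisson.isTriangularDPP (h : IsTriangularPoisson mul br Δ δ r)
    (hB : IsQuadraticPerm circB ω) (hef : IsDualHomogeneousPair ω e f) :
    IsTriangularDPP (indOp mul circB) (indOp br circB) (indCo Δ (nuOmega hB))
      (indCo δ (nuOmega hB)) (rHat e f r) where
  toIsCoboundaryDPP := h.toIsCoboundaryPoisson.isCoboundaryDPP hB hef
  ybe := isCompletedDPYBESolution_rHat hB hef h.bialg.alg.mul_flip h.bialg.alg.br_flip h.ybe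
  symm := by rw [hatTau_rHat hB hef, ← h.skew]

end Transfer

end DPP
end
open DPP in
theorem mainTheorem3 {k : Type*} [Field k] [CharZero k]
    {P : Type*} [AddCommGroup P] [Module k P] [FiniteDimensional k P]
    (mul br : Op k P) (Δ δ : P →ₗ[k] P ⊗[k] P) (hP : IsPoissonBialgebra mul br Δ δ)
    {B : ℤ → Type*} [∀ i, AddCommGroup (B i)] [∀ i, Module k (B i)]
    (circB : Op k (⨁ i, B i)) (ω : (⨁ i, B i) →ₗ[k] (⨁ i, B i) →ₗ[k] k)
    (hB : IsQuadraticPerm circB ω) :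
    IsCompletedDPPBialgebra (indOp mul circB) (indOp br circB)
        (indCo Δ (nuOmega hB)) (indCo δ (nuOmega hB)) ∧
    (∀ {Ω : Type*} (e : Module.Basis Ω k (⨁ i, B i)) (f : Ω → ⨁ i, B i),
      IsDualHomogeneousPair ω e f → ∀ r : P ⊗[k] P,
        ((∀ p, Δ p = cobDelta mul r p) → (∀ p, δ p = cobdelta br r p) →
          (∀ a, indCo Δ (nuOmega hB) a = cobNu (indOp mul circB) (rHat e f r) a) ∧
          (∀ a, indCo δ (nuOmega hB) a = cobTheta (indOp br circB) (rHat e f r) a)) ∧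
        (IsCoboundaryPoisson mul br Δ δ r →
          IsCoboundaryDPP (indOp mul circB) (indOp br circB)
            (indCo Δ (nuOmega hB)) (indCo δ (nuOmega hB)) (rHat e f r)) ∧
        (IsQuasiTriangularPoisson mul br Δ δ r →
          IsQuasiTriangularDPP (indOp mul circB) (indOp br circB)
            (indCo Δ (nuOmega hB)) (indCo δ (nuOmega hB)) (rHat e f r)) ∧
        (IsTriangularPoisson mul br Δ δ r →
          IsTriangularDPP (indOp mul circB) (indOp br circB)
            (indCo Δ (nuOmega hB)) (indCo δ (nuOmega hB)) (rHat e f r))) ∧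
    ((∃ r, IsCoboundaryPoisson mul br Δ δ r) →
      ∃ s, IsCoboundaryDPP (indOp mul circB) (indOp br circB)
        (indCo Δ (nuOmega hB)) (indCo δ (nuOmega hB)) s) ∧
    ((∃ r, IsQuasiTriangularPoisson mul br Δ δ r) →
      ∃ s, IsQuasiTriangularDPP (indOp mul circB) (indOp br circB)
        (indCo Δ (nuOmega hB)) (indCo δ (nuOmega hB)) s) ∧
    ((∃ r, IsTriangularPoisson mul br Δ δ r) →
      ∃ s, IsTriangularDPP (indOp mul circB) (indOp br circB)
        (indCo Δ (nuOmega hB)) (indCo δ (nuOmega hB)) s) := by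
  obtain ⟨_, e₀, f₀, h₀⟩ := exists_isDualHomogeneousPair hB
  refine ⟨isCompletedDPPBialgebra_ind hP hB, fun e f h r => ⟨fun hΔ hδ =>
    ⟨indCo_eq_cobNu hB h hP.alg.mul_flip hΔ, indCo_eq_cobTheta hB h hP.alg.br_flip hδ⟩,
    fun hr => hr.isCoboundaryDPP hB h, fun hr => hr.isQuasiTriangularDPP hB h,
    fun hr => hr.isTriangularDPP hB h⟩, ?_, ?_, ?_⟩
  · rintro ⟨r, hr⟩
    exact ⟨_, hr.isCoboundaryDPP hB h₀⟩
  · rintro ⟨r, hr⟩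
    exact ⟨_, hr.isQuasiTriangularDPP hB h₀⟩
  · rintro ⟨r, hr⟩
    exact ⟨_, hr.isTriangularDPP hB h₀⟩
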